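/- Conventions. $\mathbb{R}^d$ carries the Euclidean norm and Lebesgue measure; $p_E$ is the orthogonal projection onto a subspace $E$; $a\ast b$ is the element-wise product of vectors; $\nabla^k f(x)$ is the symmetric tensor of $k$-th order derivatives; a function is coercive if it tends to $+\infty$ as $\|x\|\to+\infty$. A $\mathcal{C}^{2p}$ function $f:\mathbb{R}^d\to\mathbb{R}$ has a strict polynomial local minimum of order $2p$ at $x$ if $x$ is a local minimum and $p\ge 1$ is the smallest integer for which there is $r>0$ with $\sum_{k=2}^{2p}\frac1{k!}\nabla^k f(x)\cdot h^{\otimes k}>0$ for all $0<\|h\|<r$. For such $f,x,p$, put $F_0=\mathbb{R}^d$ and $F_k=\{h\in F_{k-1}:\ \forall h'\in F_{k-1},\ \nabla^{2k}f(x)\cdot h\otimes h'^{\otimes 2k-1}=0\}$ for $1\le k\le p-1$; let $E_k$ be the orthogonal complement of $F_k$ in $F_{k-1}$ for $1\le k\le p-1$, and $E_p=F_{p-1}$. For $1\le j\le d$ let $\alpha_j=\frac1{2k}$ if $\dim E_1+\dots+\dim E_{k-1}<j\le\dim E_1+\dots+\dim E_k$. An orthogonal transformation $B$ of $\mathbb{R}^d$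 is adapted if $B e_j\in E_k$ for all such $j$ and $k$. Given an adapted $B$, let $$g(h)=\sum_{k=2}^{2p}\frac1{k!}\sum_{\substack{i_1+\dots+i_p=k\\ \frac{i_1}2+\dots+\frac{i_p}{2p}=1}}\binom{k}{i_1,\dots,i_p}\nabla^k f(x)\cdot p_{E_1}(Bh)^{\otimes i_1}\otimes\dots\otimes p_{E_p}(Bh)^{\otimes i_p}.$$ Theorem. Let $f:\mathbb{R}^d\to\mathbb{R}$ be $\mathcal{C}^{2p}$ and coercive with $e^{-f}\in L^1(\mathbb{R}^d)$. Assume that the set of global minimizers of $f$ is $\{x_1^\star,\dots,x_m^\star\}$, with the $x_i^\star$ distinct, that $f(x_i^\star)=0$ for all $i$, and that $f$ has a strict polynomial local minimum of some order $2p_i\le 2p$ at each $x_i^\star$. For each $i$ let $(E_{ik})_{1\le k\le p_i}$ and $(\alpha_{ij})_{1\le j\le d}$ be the subspaces and exponents above for $(f,x_i^\star,p_i)$, let $B_i$ be any adapted orthogonal transformation, and let $g_i$ be the corresponding function. For every $i$ with $p_i\ge5$ assume moreover that for all $h\in\mathbb{R}^d$ and all $(n_1,\dots,n_{p_i})\in\{0,2,\dots,2p_i\}^{p_i}$,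 $$\frac{n_1}{2}+\dots+\frac{n_{p_i}}{2p_i}<1\ \Longrightarrow\ \nabla^{n_1+\dots+n_{p_i}}f(x_i^\star)\cdot p_{E_{i1}}(h)^{\otimes n_1}\otimes\dots\otimes p_{E_{ip_i}}(h)^{\otimes n_{p_i}}=0.$$ Then, for every $i$ and every $h\in\mathbb{R}^d$, writing $t^{\alpha_i}=(t^{\alpha_{i1}},\dots,t^{\alpha_{id}})$, $$\frac1t f\bigl(x_i^\star+B_i\cdot(t^{\alpha_i}\ast h)\bigr)\underset{t\to0^+}{\longrightarrow}g_i(h)\in[0,\infty),$$ and $g_i$ is not constant in any of its variables. If, furthermore, every $g_i$ is coercive, then $e^{-g_i}\in L^1(\mathbb{R}^d)$ for every $i$ and the following hold as $t\to0^+$. Let $\pi_t$ be the probability measure with density proportional to $e^{-f(x)/t}$, let $X_t$ be a random vector with law $\pi_t$ ($0<t<1$), and let $J$ be the set of indices $i$ for which $\sum_{j=1}^d\alpha_{ij}$ is minimal. Then $$X_t\overset{\mathscr{L}}{\longrightarrow}\frac{1}{\sum_{j\in J}\int_{\mathbb{R}^d}e^{-g_j(x)}dx}\sum_{i\in J}\int_{\mathbb{R}^d}e^{-g_i(x)}dx\cdot\delta_{x_i^\star}.$$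 Moreover, let $\delta>0$ be such that the open balls $\mathcal{B}(x_i^\star,\delta)$ are pairwise disjoint, and let $X_{it}$ have the law of $X_t$ conditionally on $\|X_t-x_i^\star\|<\delta$. Then, for every $i$, $$\left(\frac1{t^{\alpha_{i1}}},\dots,\frac1{t^{\alpha_{id}}}\right)\ast\bigl(B_i^{-1}\cdot(X_{it}-x_i^\star)\bigr)\overset{\mathscr{L}}{\longrightarrow}X_i,$$ where $X_i$ has density proportional to $e^{-g_i}$. -/

import Mathlib

open Filter Topology MeasureTheory

namespace GibbsWell

/-- `ℝ^d` with the Euclidean norm. -/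
abbrev Space (d : ℕ) : Type := EuclideanSpace ℝ (Fin d)

/-- `f(x) → +∞` as `‖x‖ → +∞`. -/
def Coercive {d : ℕ} (f : Space d → ℝ) : Prop :=
  Tendsto f (Bornology.cobounded (Space d)) atTop

/-- The set of global minimizers of `f`. -/
def argmin {d : ℕ} (f : Space d → ℝ) : Set (Space d) :=
  {x | ∀ y, f x ≤ f y}

/-- `f` is `C^{2p}` and has a strict polynomial local minimum at `x` of order `2p`: `p ≥ 1` is the
smallest integer such that the Taylor polynomial `∑_{k=2}^{2p} ∇^k f(x) · h^{⊗k} / k!` is positive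
for all small `h ≠ 0`. -/
structure IsStrictPolynomialMin {d : ℕ} (f : Space d → ℝ) (x : Space d) (p : ℕ) : Prop where
  contDiff : ContDiff ℝ ((2 * p : ℕ) : WithTop ℕ∞) f
  isLocalMin : IsLocalMin f x
  isLeast : IsLeast {q : ℕ | 1 ≤ q ∧ ∃ r : ℝ, 0 < r ∧ ∀ h ∈ Metric.ball (0 : Space d) r, h ≠ 0 →
    0 < ∑ k ∈ Finset.Icc 2 (2 * q),
      (1 / (k.factorial : ℝ)) * iteratedFDeriv ℝ k f x (fun _ => h)} p

/-- The nested subspaces `F_0 = ℝ^d` and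
`F_{k+1} = {h ∈ F_k : ∀ h' ∈ F_k, ∇^{2(k+1)} f(x) · h ⊗ h'^{⊗(2(k+1)-1)} = 0}`. -/
noncomputable def subF {d : ℕ} (f : Space d → ℝ) (x : Space d) : ℕ → Submodule ℝ (Space d)
  | 0 => ⊤
  | k + 1 =>
    { carrier := {h | h ∈ subF f x k ∧ ∀ h' ∈ subF f x k,
        iteratedFDeriv ℝ (2 * k + 2) f x (Fin.cons h (fun _ : Fin (2 * k + 1) => h')) = 0}
      zero_mem' := by
        refine ⟨(subF f x k).zero_mem, fun h' _ => ?_⟩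
        exact (iteratedFDeriv ℝ (2 * k + 2) f x).map_coord_zero 0 (Fin.cons_zero _ _)
      add_mem' := by
        rintro a b ⟨ha, ha'⟩ ⟨hb, hb'⟩
        refine ⟨(subF f x k).add_mem ha hb, fun h' hh' => ?_⟩
        have := (iteratedFDeriv ℝ (2 * k + 2) f x).cons_add
          (fun _ : Fin (2 * k + 1) => h') a b
        rw [this, ha' h' hh', hb' h' hh', add_zero]
      smul_mem' := by
        rintro c a ⟨ha, ha'⟩
        refine ⟨(subF f x k).smul_mem c ha, fun h' hh' => ?_⟩
        have := (iteratedFDeriv ℝ (2 * k + 2) f x).cons_smul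
          (fun _ : Fin (2 * k + 1) => h') c a
        rw [this, ha' h' hh', smul_zero] }

/-- The subspaces `E_1, …, E_p` (here indexed by `j = 0, …, p - 1`): for `k ≤ p - 1`, `E_k` is the
orthogonal complement of `F_k` in `F_{k-1}`, and `E_p = F_{p-1}`. -/
noncomputable def subE {d : ℕ} (f : Space d → ℝ) (x : Space d) (p : ℕ) (j : Fin p) :
    Submodule ℝ (Space d) :=
  if (j : ℕ) + 1 < p then subF f x j ⊓ (subF f x (j + 1))ᗮ else subF f x j

/-- The coordinates (counted from `0`) that belong to the `j`-th summand:
`dim E_1 + ⋯ + dim E_{j-1} ≤ i < dim E_1 + ⋯ + dim E_j`. -/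
noncomputable def block {d p : ℕ} (E : Fin p → Submodule ℝ (Space d)) (j : Fin p) :
    Finset (Fin d) :=
  Finset.univ.filter fun i : Fin d =>
    ∑ l ∈ Finset.Iio j, Module.finrank ℝ (E l) ≤ (i : ℕ) ∧
      (i : ℕ) < ∑ l ∈ Finset.Iic j, Module.finrank ℝ (E l)

/-- The orthogonal transformation `B` is adapted to `ℝ^d = E_1 ⊕ ⋯ ⊕ E_p`. -/
def IsAdapted {d p : ℕ} (B : Space d ≃ₗᵢ[ℝ] Space d) (E : Fin p → Submodule ℝ (Space d)) : Prop :=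
  ∀ j : Fin p, ∀ i ∈ block E j, B (EuclideanSpace.single i 1) ∈ E j

/-- `α_i = 1 / (2 j)` when the coordinate `i` belongs to the block of `E_j`, `1 ≤ j ≤ p`
(the blocks are disjoint, so at most one term of the sum is non-zero). -/
noncomputable def exponent {d p : ℕ} (E : Fin p → Submodule ℝ (Space d)) (i : Fin d) : ℝ :=
  ∑ j : Fin p, if i ∈ block E j then 1 / (2 * ((j : ℝ) + 1)) else 0

/-- `i_1 / 2 + i_2 / 4 + ⋯ + i_p / (2 p)`. -/
def weight {p : ℕ} (i : Fin p → ℕ) : ℚ :=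
  ∑ j : Fin p, (i j : ℚ) / (2 * ((j : ℚ) + 1))

/-- `∇^{i_1 + ⋯ + i_p} f(x) · v_1^{⊗ i_1} ⊗ ⋯ ⊗ v_p^{⊗ i_p}`. -/
noncomputable def tensorTerm {d p : ℕ} (f : Space d → ℝ) (x : Space d) (i : Fin p → ℕ)
    (v : Fin p → Space d) : ℝ :=
  iteratedFDeriv ℝ (∑ j, i j) f x (fun l => v (finSigmaFinEquiv.symm l).1)

/-- The polynomial `g` attached to `f`, `x`, `p` and the orthogonal transformation `B`. -/
noncomputable def limitG {d : ℕ} (f : Space d → ℝ) (x : Space d) (p : ℕ)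
    (B : Space d ≃ₗᵢ[ℝ] Space d) (h : Space d) : ℝ :=
  ∑ k ∈ Finset.Icc 2 (2 * p), (1 / (k.factorial : ℝ)) *
    ∑ i ∈ (Finset.piAntidiag (Finset.univ : Finset (Fin p)) k).filter (fun i => weight i = 1),
      (Nat.multinomial Finset.univ i : ℝ) *
        tensorTerm f x i (fun j => (subE f x p j).starProjection (B h))

/-- The technical hypothesis: all the terms with even exponents and weight less than `1` vanish. -/
def EvenTermsVanish {d : ℕ} (f : Space d → ℝ) (x : Space d) (p : ℕ) : Prop :=
  ∀ h : Space d, ∀ i : Fin p → ℕ, (∀ j, Even (i j) ∧ i j ≤ 2 * p) → weight i < 1 →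
    tensorTerm f x i (fun j => (subE f x p j).starProjection h) = 0

/-- The element-wise product of two vectors. -/
noncomputable def hadamard {d : ℕ} (a b : Space d) : Space d :=
  WithLp.toLp 2 fun i => a i * b i

/-- The vector `(t^{α_1}, …, t^{α_d})`. -/
noncomputable def powVec {d : ℕ} (t : ℝ) (α : Fin d → ℝ) : Space d :=
  WithLp.toLp 2 fun i => t ^ α i

/-- The vector `(1 / t^{α_1}, …, 1 / t^{α_d})`. -/
noncomputable def invPowVec {d : ℕ} (t : ℝ) (α : Fin d → ℝ) : Space d :=
  WithLp.toLp 2 fun i => 1 / t ^ α i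

/-- `g` is constant in none of its variables. -/
def NonconstantInEachVariable {d : ℕ} (g : Space d → ℝ) : Prop :=
  ∀ j : Fin d, ∃ h h' : Space d, (∀ l, l ≠ j → h l = h' l) ∧ g h ≠ g h'

/-- The Gibbs measure `π_t`, of density `e^{-f(x)/t} / ∫ e^{-f/t}` with respect to Lebesgue
measure. -/
noncomputable def gibbs {d : ℕ} (f : Space d → ℝ) (t : ℝ) : Measure (Space d) :=
  (volume : Measure (Space d)).tilted (fun x => -f x / t)

/-- Weak convergence, as `t → 0+`, of the probability measures `μ t` to the probability
measure `ν`. -/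
def WeaklyConverges {d : ℕ} (μ : ℝ → Measure (Space d)) (ν : Measure (Space d)) : Prop :=
  (∀ᶠ t in 𝓝[>] (0 : ℝ), IsProbabilityMeasure (μ t)) ∧ IsProbabilityMeasure ν ∧
    ∀ φ : BoundedContinuousFunction (Space d) ℝ,
      Tendsto (fun t => ∫ y, φ y ∂(μ t)) (𝓝[>] (0 : ℝ)) (𝓝 (∫ y, φ y ∂ν))

/-- The indices `i` for which `∑_j a_{ij}` is minimal. -/
noncomputable def minimalIndices {d m : ℕ} (a : Fin m → Fin d → ℝ) : Finset (Fin m) :=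
  open scoped Classical in
  Finset.univ.filter fun i => ∀ k, ∑ j, a i j ≤ ∑ j, a k j

/-- The mixture `(∑_{i ∈ J} w_i)⁻¹ ∑_{i ∈ J} w_i δ_{x_i}`. -/
noncomputable def diracMixture {d m : ℕ} (J : Finset (Fin m)) (w : Fin m → ℝ)
    (x : Fin m → Space d) : Measure (Space d) :=
  ∑ i ∈ J, ENNReal.ofReal (w i / ∑ k ∈ J, w k) • Measure.dirac (x i)

end GibbsWell

/-! Near a minimizer, the directions of `E_j` (counted from 0) are given the scale t^(1/(2(j+1))).
The Taylor monomial of multi-index i then scales as t^(weight i): weights above 1 are o(t), weight 1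
builds g, and everything rests on the absence of monomials of weight below 1. When all exponents are
even, this absence follows from the definition of the spaces F_k if p ≤ 4, and is assumed if p ≥ 5.
The other monomials are removed by positivity (`tensorTerm_eq_zero_of_weight_lt_one`): if w < 1 is
the lowest surviving weight, f(x + y(t)) / t^w tends to a polynomial in the amplitudes of the
directions, which is nonnegative because x is a minimum. Averaging it over sign changes kills every
monomial with an odd exponent, so the average is 0 and the polynomial vanishes identically.

For integrals the expansion must be uniform. With the gauge N(h) = ∑ h_i^(2(κ i + 1)), which the
scaling multiplies by t, one has f(x + Bh) - g(h) = o(N(h)) (`sub_limitG_isLittleO_gauge`). If g is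
coercive, quasi-homogeneity forces g ≥ cN, hence f(x + Bh) ≥ c'N(h) on a ball without other
minimizers. After the change of variables e^(-f/t) is dominated by e^(-c'N), and dominated
convergence gives the local asymptotics, with the factor t^(∑ α) (`tendsto_local_laplace`). Away
from the minimizers the contribution is exponentially small. Both limit laws are quotients of such
asymptotics; in the first, only the minima with the smallest ∑ α survive.

For the nonconstancy, g restricted to one block is a single derivative form of f. If g is constant
in a coordinate of a block other than the last, that coordinate direction lies in the next F, to
which the block is orthogonal; on the last block the form cannot vanish, by the strict positivity of
the Taylor polynomial. -/

namespace GibbsWell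

/-! ### Symmetry of higher derivatives and Taylor's formula -/

section Calculus

variable {E : Type*} [NormedAddCommGroup E] [NormedSpace ℝ E]

theorem fderiv_iteratedFDeriv_apply {f : E → ℝ} {n : ℕ}
    (hf : ContDiff ℝ ((n + 1 : ℕ) : WithTop ℕ∞) f) (x a : E) (w : Fin n → E) :
    fderiv ℝ (fun y => iteratedFDeriv ℝ n f y w) x a
      = iteratedFDeriv ℝ (n + 1) f x (Fin.cons a w) := by
  have hd : DifferentiableAt ℝ (iteratedFDeriv ℝ n f) x :=
    (hf.differentiable_iteratedFDeriv (by exact_mod_cast Nat.lt_succ_self n)) x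
  have := ((ContinuousMultilinearMap.apply ℝ (fun _ : Fin n => E) ℝ w).hasFDerivAt.comp x
    hd.hasFDerivAt).fderiv
  rw [iteratedFDeriv_succ_apply_left, Fin.cons_zero, Fin.tail_cons]
  exact congrArg (fun L => L a) this

/-- Both sides are second derivatives of y ↦ D^n f(y) w, so the exchange is Schwarz's theorem. -/
theorem iteratedFDeriv_cons_cons_swap {f : E → ℝ} {n : ℕ}
    (hf : ContDiff ℝ ((n + 2 : ℕ) : WithTop ℕ∞) f) (x a b : E) (w : Fin n → E) :
    iteratedFDeriv ℝ (n + 2) f x (Fin.cons b (Fin.cons a w))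
      = iteratedFDeriv ℝ (n + 2) f x (Fin.cons a (Fin.cons b w)) := by
  set G : E → ℝ := fun y => iteratedFDeriv ℝ n f y w with hG
  have hf1 : ContDiff ℝ ((n + 1 : ℕ) : WithTop ℕ∞) f :=
    hf.of_le (by exact_mod_cast Nat.le_succ _)
  have hG2 : ContDiff ℝ 2 G := by
    have h1 : ContDiff ℝ 2 (iteratedFDeriv ℝ n f) :=
      hf.iteratedFDeriv_right (m := 2) (i := n) (by exact_mod_cast (Nat.add_comm 2 n).le)
    exact (ContinuousMultilinearMap.apply ℝ (fun _ : Fin n => E) ℝ w).contDiff.comp h1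
  have hfd : Differentiable ℝ (fderiv ℝ G) :=
    (hG2.fderiv_right (m := 1) (by norm_num)).differentiable (by norm_num)
  have key : ∀ a b : E, iteratedFDeriv ℝ (n + 2) f x (Fin.cons b (Fin.cons a w))
      = fderiv ℝ (fderiv ℝ G) x b a := by
    intro a b
    rw [← fderiv_iteratedFDeriv_apply hf]
    have : (fun y => iteratedFDeriv ℝ (n + 1) f y (Fin.cons a w))
        = fun y => fderiv ℝ G y a := by
      funext y
      exact (fderiv_iteratedFDeriv_apply hf1 y a w).symm
    rw [this]
    have h2 := ((ContinuousLinearMap.apply ℝ ℝ a).hasFDerivAt.comp x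
      (hfd x).hasFDerivAt).fderiv
    exact congrArg (fun L => L b) h2
  rw [key, key]
  exact (hG2.contDiffAt.isSymmSndFDerivAt (by simp)).eq b a

/-- The iterated derivative of a `C^n` function is symmetric. -/
theorem iteratedFDeriv_comp_perm {f : E → ℝ} {n : ℕ}
    (hf : ContDiff ℝ (n : WithTop ℕ∞) f) (x : E) (v : Fin n → E) (σ : Equiv.Perm (Fin n)) :
    iteratedFDeriv ℝ n f x (v ∘ σ) = iteratedFDeriv ℝ n f x v := by
  induction n generalizing x with
  | zero => rw [Subsingleton.elim (v ∘ σ) v]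
  | succ n ih =>
    -- Adjacent transpositions suffice. The one exchanging 0 and 1 is Schwarz's theorem; those
    -- fixing 0 follow by differentiating the induction hypothesis in the direction `v 0`.
    have hσ : σ ∈ Submonoid.closure
        (Set.range fun i : Fin n => Equiv.swap i.castSucc i.succ) := by
      rw [Equiv.Perm.mclosure_swap_castSucc_succ]; trivial
    induction hσ using Submonoid.closure_induction generalizing v with
    | one => rfl
    | mul a b _ _ ha hb => exact (hb (v ∘ a)).trans (ha v)
    | mem τ hτ =>
      obtain ⟨i, rfl⟩ := hτ
      have hfn : ContDiff ℝ (n : WithTop ℕ∞) f := hf.of_le (by exact_mod_cast Nat.le_succ _)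
      rcases n with _ | n
      · exact i.elim0
      refine Fin.cases ?_ (fun j => ?_) i
      · have hv : v = Fin.cons (v 0) (Fin.cons (v 1) (Fin.tail (Fin.tail v))) := by
          rw [show v 1 = Fin.tail v 0 from rfl, Fin.cons_self_tail, Fin.cons_self_tail]
        have hv' : v ∘ Equiv.swap (Fin.castSucc 0) (Fin.succ 0)
            = Fin.cons (v 1) (Fin.cons (v 0) (Fin.tail (Fin.tail v))) := by
          funext k
          refine Fin.cases ?_ (fun k => ?_) k
          · simp
          · refine Fin.cases ?_ (fun k => ?_) k
            · simp
            · have h1 : (k.succ.succ : Fin (n + 2)) ≠ Fin.castSucc 0 := by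
                simp [Fin.ext_iff]
              have h2 : (k.succ.succ : Fin (n + 2)) ≠ Fin.succ 0 := by
                simp [Fin.ext_iff]
              rw [Function.comp_apply, Equiv.swap_apply_of_ne_of_ne h1 h2]
              simp [Fin.tail]
        rw [hv', iteratedFDeriv_cons_cons_swap hf, ← hv]
      · have hv' : v ∘ Equiv.swap (Fin.castSucc j.succ) (Fin.succ j.succ)
            = Fin.cons (v 0) (Fin.tail v ∘ Equiv.swap j.castSucc j.succ) := by
          funext k
          refine Fin.cases ?_ (fun k => ?_) k
          · rw [Function.comp_apply, Equiv.swap_apply_of_ne_of_ne]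
            · simp
            · simp [Fin.ext_iff]
            · simp [Fin.ext_iff]
          · simp only [Function.comp_apply, Fin.cons_succ, Fin.tail]
            congr 1
            rw [← Fin.succ_castSucc]
            exact ((Fin.succ_injective _).map_swap _ _ _).symm
        rw [hv', ← fderiv_iteratedFDeriv_apply hf]
        have : (fun y => iteratedFDeriv ℝ (n + 1) f y
            (Fin.tail v ∘ Equiv.swap j.castSucc j.succ))
            = fun y => iteratedFDeriv ℝ (n + 1) f y (Fin.tail v) := by
          funext y
          exact ih hfn y _ _
        rw [this, fderiv_iteratedFDeriv_apply hf, Fin.cons_self_tail]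

theorem iteratedDeriv_along_line {f : E → ℝ} {n : ℕ}
    (hf : ContDiff ℝ (n : WithTop ℕ∞) f) (x h : E) (s : ℝ) :
    iteratedDeriv n (fun s : ℝ => f (x + s • h)) s
      = iteratedFDeriv ℝ n f (x + s • h) (fun _ => h) := by
  induction n generalizing s with
  | zero => simp
  | succ n ih =>
    have hfn : ContDiff ℝ (n : WithTop ℕ∞) f := hf.of_le (by exact_mod_cast Nat.le_succ _)
    rw [iteratedDeriv_succ, funext (ih hfn)]
    have hd : DifferentiableAt ℝ (fun y => iteratedFDeriv ℝ n f y fun _ => h) (x + s • h) := by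
      have h1 : DifferentiableAt ℝ (iteratedFDeriv ℝ n f) (x + s • h) :=
        (hf.differentiable_iteratedFDeriv (by exact_mod_cast Nat.lt_succ_self n)) _
      exact (ContinuousMultilinearMap.apply ℝ (fun _ : Fin n => E) ℝ
        (fun _ => h)).differentiableAt.comp _ h1
    have hl : HasDerivAt (fun s : ℝ => x + s • h) h s := by
      simpa using ((hasDerivAt_id s).smul_const h).const_add x
    have := (hd.hasFDerivAt.comp_hasDerivAt s hl).deriv
    rw [show (fun s : ℝ => iteratedFDeriv ℝ n f (x + s • h) fun _ => h)
      = (fun y => iteratedFDeriv ℝ n f y fun _ => h) ∘ (fun s : ℝ => x + s • h) from rfl, this,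
      fderiv_iteratedFDeriv_apply hf]
    congr 1
    funext k
    exact Fin.cases rfl (fun _ => rfl) k

/-- The Taylor polynomial of degree `n` of `f` at `x`. -/
noncomputable def taylorPoly (f : E → ℝ) (x : E) (n : ℕ) (h : E) : ℝ :=
  ∑ k ∈ Finset.range (n + 1), (1 / (k.factorial : ℝ)) * iteratedFDeriv ℝ k f x (fun _ => h)

/-- One-variable Lagrange remainder for s ↦ f(x + s h) on [0, 1]. -/
theorem exists_taylor_lagrange {f : E → ℝ} {n : ℕ}
    (hf : ContDiff ℝ ((n + 1 : ℕ) : WithTop ℕ∞) f) (x h : E) :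
    ∃ s ∈ Set.Ioo (0 : ℝ) 1, f (x + h) - taylorPoly f x n h
      = (1 / ((n + 1).factorial : ℝ)) *
        iteratedFDeriv ℝ (n + 1) f (x + s • h) (fun _ => h) := by
  have hφ : ContDiff ℝ ((n + 1 : ℕ) : WithTop ℕ∞) (fun s : ℝ => f (x + s • h)) :=
    hf.comp (by fun_prop)
  obtain ⟨s, hs, he⟩ := taylor_mean_remainder_lagrange_iteratedDeriv (zero_ne_one' ℝ)
    (n := n) (f := fun s : ℝ => f (x + s • h)) (by exact_mod_cast hφ.contDiffOn)
  rw [Set.uIoo_of_lt one_pos] at hs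
  refine ⟨s, hs, ?_⟩
  rw [iteratedDeriv_along_line hf] at he
  simp only [one_smul, sub_zero, one_pow, mul_one] at he
  rw [one_div_mul_eq_div, ← he, taylor_within_apply, taylorPoly]
  congr 1
  refine Finset.sum_congr rfl fun k hk => ?_
  have hkn : ContDiff ℝ (k : WithTop ℕ∞) f :=
    hf.of_le (by exact_mod_cast (Finset.mem_range.1 hk).le)
  have hkφ : ContDiff ℝ (k : WithTop ℕ∞) (fun s : ℝ => f (x + s • h)) := hkn.comp (by fun_prop)
  rw [iteratedDerivWithin_eq_iteratedDeriv (uniqueDiffOn_uIcc (zero_ne_one' ℝ))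
    hkφ.contDiffAt (by simp), iteratedDeriv_along_line hkn]
  simp

/-- Taylor's theorem with Peano remainder. -/
theorem taylorPoly_isLittleO {f : E → ℝ} {n : ℕ} (hn : n ≠ 0)
    (hf : ContDiff ℝ (n : WithTop ℕ∞) f) (x : E) :
    (fun h => f (x + h) - taylorPoly f x n h) =o[𝓝 0] fun h => ‖h‖ ^ n := by
  obtain ⟨n, rfl⟩ := Nat.exists_eq_succ_of_ne_zero hn
  rw [Asymptotics.isLittleO_iff]
  intro c hc
  have hcont : Continuous (iteratedFDeriv ℝ (n + 1) f) := hf.continuous_iteratedFDeriv le_rfl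
  obtain ⟨r, hr, hball⟩ := Metric.continuous_iff.1 hcont x c hc
  filter_upwards [Metric.ball_mem_nhds (0 : E) hr] with h hh
  obtain ⟨s, hs, he⟩ := exists_taylor_lagrange hf x h
  -- With the top-degree term moved into the polynomial, the remainder is a difference of top
  -- derivatives at x + s h and at x, which continuity makes small.
  have hP : taylorPoly f x (n + 1) h = taylorPoly f x n h + (1 / ((n + 1).factorial : ℝ)) *
      iteratedFDeriv ℝ (n + 1) f x (fun _ => h) := Finset.sum_range_succ _ _
  have hd : dist (iteratedFDeriv ℝ (n + 1) f (x + s • h)) (iteratedFDeriv ℝ (n + 1) f x) < c := by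
    apply hball
    rw [dist_eq_norm, add_sub_cancel_left, norm_smul, Real.norm_of_nonneg hs.1.le]
    have : ‖h‖ < r := by simpa using hh
    nlinarith [hs.1, hs.2, norm_nonneg h]
  have hop : ‖(iteratedFDeriv ℝ (n + 1) f (x + s • h) - iteratedFDeriv ℝ (n + 1) f x)
      (fun _ => h)‖ ≤ c * ‖h‖ ^ (n + 1) := by
    refine (ContinuousMultilinearMap.le_opNorm _ _).trans ?_
    rw [Finset.prod_const, Finset.card_univ, Fintype.card_fin, ← dist_eq_norm]
    gcongr
  have hfac : (1 / ((n + 1).factorial : ℝ)) ≤ 1 := by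
    rw [div_le_one (by positivity)]
    exact_mod_cast Nat.succ_le_of_lt (Nat.factorial_pos _)
  have h0 : (0 : ℝ) ≤ 1 / ((n + 1).factorial : ℝ) := by positivity
  have heq : f (x + h) - taylorPoly f x (n + 1) h = (1 / ((n + 1).factorial : ℝ)) *
      (iteratedFDeriv ℝ (n + 1) f (x + s • h) - iteratedFDeriv ℝ (n + 1) f x) (fun _ => h) := by
    rw [hP, sub_apply, mul_sub, ← he]; ring
  rw [Nat.succ_eq_add_one, heq, norm_mul, Real.norm_of_nonneg h0, norm_pow, norm_norm]
  calc _ ≤ 1 * (c * ‖h‖ ^ (n + 1)) := by gcongr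
    _ = _ := one_mul _

end Calculus

/-! ### Words, multi-indices and coefficients of polynomials -/

section MultiIndex

variable {ι : Type*} [Fintype ι]

/-- The monomial with exponents `i`. -/
noncomputable def expMonomial (i : ι → ℕ) : MvPolynomial ι ℝ :=
  MvPolynomial.monomial (Finsupp.equivFunOnFinite.symm i) 1

theorem expMonomial_eq_prod (i : ι → ℕ) :
    expMonomial i = ∏ j, (MvPolynomial.X j : MvPolynomial ι ℝ) ^ i j := by
  rw [expMonomial, MvPolynomial.monomial_eq, Finsupp.prod_fintype _ _ (by simp)]
  simp

variable [DecidableEq ι] {n : ℕ}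

/-- The number of times each letter occurs in a word. -/
def letterCount (r : Fin n → ι) (j : ι) : ℕ :=
  (Finset.univ.filter fun l => r l = j).card

theorem sum_letterCount (r : Fin n → ι) : ∑ j, letterCount r j = n := by
  have := Finset.card_eq_sum_card_fiberwise (f := r) (s := Finset.univ) (t := Finset.univ)
    (fun _ _ => Finset.mem_coe.2 (Finset.mem_univ _))
  simpa [letterCount] using this.symm

theorem letterCount_mem_piAntidiag (r : Fin n → ι) :
    letterCount r ∈ Finset.piAntidiag (Finset.univ : Finset ι) n := by
  simp [Finset.mem_piAntidiag, sum_letterCount]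

theorem prod_comp_word {R : Type*} [CommMonoid R] (r : Fin n → ι) (s : ι → R) :
    ∏ l, s (r l) = ∏ j, s j ^ letterCount r j := by
  rw [← Finset.prod_fiberwise (s := Finset.univ) (g := r)]
  refine Finset.prod_congr rfl fun j _ => ?_
  rw [letterCount, ← Finset.prod_const]
  exact Finset.prod_congr rfl fun l hl => by rw [(Finset.mem_filter.1 hl).2]

theorem coeff_sum_smul_expMonomial {κ : Type*} (S : Finset κ) (a : κ → ℝ) (e : κ → ι → ℕ)
    (i : ι → ℕ) :
    MvPolynomial.coeff (Finsupp.equivFunOnFinite.symm i)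
      (∑ k ∈ S, MvPolynomial.C (a k) * expMonomial (e k)) = ∑ k ∈ S with e k = i, a k := by
  rw [MvPolynomial.coeff_sum, Finset.sum_filter]
  refine Finset.sum_congr rfl fun k _ => ?_
  rw [MvPolynomial.coeff_C_mul, expMonomial, MvPolynomial.coeff_monomial]
  simp

/-- If a polynomial function vanishes identically, the coefficients vanish. -/
theorem coeff_eq_zero_of_sum_eq_zero {κ : Type*} (S : Finset κ) (a : κ → ℝ) (e : κ → ι → ℕ)
    (h : ∀ s : ι → ℝ, ∑ k ∈ S, a k * ∏ j, s j ^ e k j = 0) (i : ι → ℕ) :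
    ∑ k ∈ S with e k = i, a k = 0 := by
  have : (∑ k ∈ S, MvPolynomial.C (a k) * expMonomial (e k)) = 0 := by
    refine MvPolynomial.funext fun s => ?_
    rw [map_zero, ← h s, map_sum]
    refine Finset.sum_congr rfl fun k _ => ?_
    simp [expMonomial_eq_prod]
  rw [← coeff_sum_smul_expMonomial S a e i, this, MvPolynomial.coeff_zero]

/-- The coefficient of the monomial `i` in (∑ X_j)^n is computed twice: by expanding over words, and
by the multinomial theorem. -/
theorem card_letterCount_eq {i : ι → ℕ}
    (hi : i ∈ Finset.piAntidiag (Finset.univ : Finset ι) n) :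
    ((Finset.univ.filter fun r : Fin n → ι => letterCount r = i).card : ℝ)
      = Nat.multinomial Finset.univ i := by
  have h1 : (∑ j : ι, (MvPolynomial.X j : MvPolynomial ι ℝ)) ^ n
      = ∑ r : Fin n → ι, MvPolynomial.C 1 * expMonomial (letterCount r) := by
    calc (∑ j : ι, (MvPolynomial.X j : MvPolynomial ι ℝ)) ^ n
        = ∏ _l : Fin n, ∑ j : ι, (MvPolynomial.X j : MvPolynomial ι ℝ) := by simp
      _ = ∑ r : Fin n → ι, ∏ l, (MvPolynomial.X (r l) : MvPolynomial ι ℝ) := by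
        rw [Finset.prod_univ_sum, Fintype.piFinset_univ]
      _ = _ := by
        refine Finset.sum_congr rfl fun r _ => ?_
        rw [prod_comp_word r (fun j => (MvPolynomial.X j : MvPolynomial ι ℝ)),
          expMonomial_eq_prod, map_one, one_mul]
  have h2 : (∑ j : ι, (MvPolynomial.X j : MvPolynomial ι ℝ)) ^ n
      = ∑ k ∈ Finset.piAntidiag (Finset.univ : Finset ι) n,
        MvPolynomial.C (Nat.multinomial Finset.univ k : ℝ) * expMonomial k := by
    rw [Finset.sum_pow_eq_sum_piAntidiag]
    refine Finset.sum_congr rfl fun k _ => ?_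
    rw [expMonomial_eq_prod, map_natCast]
  have h3 := congrArg (MvPolynomial.coeff (Finsupp.equivFunOnFinite.symm i)) (h1.symm.trans h2)
  rw [coeff_sum_smul_expMonomial, coeff_sum_smul_expMonomial _ _ (fun k => k)] at h3
  rw [Finset.sum_filter (fun k => k = i), Finset.sum_ite_eq' , if_pos hi] at h3
  rw [← h3]; simp

theorem sum_comp_letterCount (G : (ι → ℕ) → ℝ) :
    ∑ r : Fin n → ι, G (letterCount r)
      = ∑ i ∈ Finset.piAntidiag (Finset.univ : Finset ι) n,
        (Nat.multinomial Finset.univ i : ℝ) * G i := by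
  rw [← Finset.sum_fiberwise_of_maps_to (g := letterCount)
    (fun r _ => letterCount_mem_piAntidiag r)]
  refine Finset.sum_congr rfl fun i hi => ?_
  rw [← card_letterCount_eq hi, ← nsmul_eq_mul, ← Finset.sum_const]
  exact Finset.sum_congr rfl fun r hr => by rw [(Finset.mem_filter.1 hr).2]

end MultiIndex

/-! ### Polarization of symmetric multilinear maps -/

section Polarization

/-- Equal counts make the fibres of the two words equinumerous; bijections between fibres glue to a
permutation. -/
theorem exists_perm_of_letterCount_eq {ι : Type*} [DecidableEq ι] {n : ℕ}
    {r r' : Fin n → ι} (h : letterCount r = letterCount r') :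
    ∃ σ : Equiv.Perm (Fin n), r = r' ∘ σ := by
  have hc : ∀ c, Nonempty ({a // r a = c} ≃ {b // r' b = c}) := fun c => by
    refine ⟨Fintype.equivOfCardEq ?_⟩
    rw [Fintype.card_subtype, Fintype.card_subtype]
    exact congrFun h c
  refine ⟨Equiv.ofFiberEquiv fun c => (hc c).some, funext fun a => ?_⟩
  exact (Equiv.ofFiberEquiv_map (fun c => (hc c).some) a).symm

variable {E : Type*} [AddCommGroup E] [Module ℝ E] {n : ℕ}

theorem map_sum_smul_word {ι : Type*} [Fintype ι] [DecidableEq ι]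
    (M : MultilinearMap ℝ (fun _ : Fin n => E) ℝ) (s : ι → ℝ) (b : ι → E) :
    M (fun _ => ∑ j, s j • b j)
      = ∑ r : Fin n → ι, M (fun l => b (r l)) * ∏ j, s j ^ letterCount r j := by
  rw [M.map_sum (fun _ j => s j • b j)]
  refine Finset.sum_congr rfl fun r _ => ?_
  rw [M.map_smul_univ (fun l => s (r l)) (fun l => b (r l)), prod_comp_word, smul_eq_mul, mul_comm]

/-- Polarization: a symmetric multilinear map is determined by its diagonal. -/
theorem eq_zero_of_diagonal_eq_zero
    (M : MultilinearMap ℝ (fun _ : Fin n => E) ℝ)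
    (hM : ∀ (v : Fin n → E) (σ : Equiv.Perm (Fin n)), M (v ∘ σ) = M v) (b : Fin n → E)
    (h : ∀ s : Fin n → ℝ, M (fun _ => ∑ j, s j • b j) = 0) : M b = 0 := by
  -- The diagonal is a polynomial in s. Its coefficient at the product of all variables, the count
  -- of the identity word, is by symmetry a positive multiple of `M b`.
  have h0 := coeff_eq_zero_of_sum_eq_zero Finset.univ
    (fun r : Fin n → Fin n => M (fun l => b (r l))) letterCount
    (fun s => by rw [← map_sum_smul_word M, h]) (letterCount (id : Fin n → Fin n))
  have h1 : ∀ r ∈ Finset.univ.filter (fun r : Fin n → Fin n => letterCount r = letterCount id),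
      M (fun l => b (r l)) = M b := by
    intro r hr
    obtain ⟨σ, hσ⟩ := exists_perm_of_letterCount_eq (Finset.mem_filter.1 hr).2
    rw [hσ]
    exact hM b σ
  rw [Finset.sum_congr rfl h1, Finset.sum_const, nsmul_eq_mul] at h0
  refine (mul_eq_zero.1 h0).resolve_left ?_
  have : (0 : ℕ) < (Finset.univ.filter
      (fun r : Fin n → Fin n => letterCount r = letterCount id)).card :=
    Finset.card_pos.2 ⟨id, by simp⟩
  exact_mod_cast this.ne'

end Polarization

/-! ### Multi-index form of the Taylor expansion -/

section TensorTerm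

variable {d p : ℕ} {f : Space d → ℝ} {x : Space d}

theorem letterCount_sigma (i : Fin p → ℕ) :
    letterCount (fun l : Fin (∑ j, i j) => (finSigmaFinEquiv.symm l).1) = i := by
  funext j
  rw [letterCount, ← Fintype.card_subtype]
  rw [← Fintype.card_fin (i j)]
  refine Fintype.card_congr ((finSigmaFinEquiv.symm.subtypeEquiv (q := fun y => y.1 = j)
    (fun _ => Iff.rfl)).trans ?_)
  exact Equiv.sigmaSubtype j

/-- By symmetry the value depends on the letter counts only, and `tensorTerm` is the value at the
word sorted by letter. -/
theorem iteratedFDeriv_word {n : ℕ} (hf : ContDiff ℝ (n : WithTop ℕ∞) f) (r : Fin n → Fin p)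
    (v : Fin p → Space d) :
    iteratedFDeriv ℝ n f x (fun l => v (r l)) = tensorTerm f x (letterCount r) v := by
  -- The counts are generalized to `i` so that `n` can be replaced by `∑ j, i j`, the order of the
  -- derivative in `tensorTerm`.
  have key : ∀ (i : Fin p → ℕ), letterCount r = i →
      iteratedFDeriv ℝ n f x (fun l => v (r l)) = tensorTerm f x i v := by
    intro i hi
    have hn : n = ∑ j, i j := by rw [← hi, sum_letterCount]
    subst hn
    obtain ⟨σ, hσ⟩ := exists_perm_of_letterCount_eq (hi.trans (letterCount_sigma i).symm)
    rw [hσ]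
    exact iteratedFDeriv_comp_perm hf x (fun l => v (finSigmaFinEquiv.symm l).1) σ
  exact key _ rfl

theorem tensorTerm_smul (i : Fin p → ℕ) (s : Fin p → ℝ) (v : Fin p → Space d) :
    tensorTerm f x i (fun j => s j • v j) = (∏ j, s j ^ i j) * tensorTerm f x i v := by
  rw [tensorTerm, tensorTerm]
  have := (iteratedFDeriv ℝ (∑ j, i j) f x).map_smul_univ
    (fun l => s (finSigmaFinEquiv.symm l).1) (fun l => v (finSigmaFinEquiv.symm l).1)
  rw [this, prod_comp_word (fun l : Fin (∑ j, i j) => (finSigmaFinEquiv.symm l).1) s,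
    letterCount_sigma, smul_eq_mul]

theorem tensorTerm_eq_zero_of_eq_zero (i : Fin p → ℕ) (v : Fin p → Space d) (j : Fin p)
    (hj : i j ≠ 0) (hv : v j = 0) : tensorTerm f x i v = 0 := by
  rw [tensorTerm]
  refine (iteratedFDeriv ℝ (∑ j, i j) f x).map_coord_zero
    (finSigmaFinEquiv ⟨j, ⟨0, Nat.pos_of_ne_zero hj⟩⟩) ?_
  simp [hv]

theorem abs_tensorTerm_le (i : Fin p → ℕ) (v : Fin p → Space d) :
    |tensorTerm f x i v| ≤ ‖iteratedFDeriv ℝ (∑ j, i j) f x‖ * ∏ j, ‖v j‖ ^ i j := by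
  rw [tensorTerm, ← Real.norm_eq_abs]
  refine (ContinuousMultilinearMap.le_opNorm _ _).trans_eq ?_
  rw [prod_comp_word (fun l : Fin (∑ j, i j) => (finSigmaFinEquiv.symm l).1) (fun j => ‖v j‖),
    letterCount_sigma]

theorem continuous_tensorTerm (i : Fin p → ℕ) {v : Fin p → Space d → Space d}
    (hv : ∀ j, Continuous (v j)) : Continuous fun h => tensorTerm f x i (fun j => v j h) :=
  (iteratedFDeriv ℝ (∑ j, i j) f x).cont.comp (continuous_pi fun _ => hv _)

theorem iteratedFDeriv_sum_eq {n : ℕ} (hf : ContDiff ℝ (n : WithTop ℕ∞) f)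
    (v : Fin p → Space d) :
    iteratedFDeriv ℝ n f x (fun _ => ∑ j, v j)
      = ∑ i ∈ Finset.piAntidiag (Finset.univ : Finset (Fin p)) n,
        (Nat.multinomial Finset.univ i : ℝ) * tensorTerm f x i v := by
  rw [(iteratedFDeriv ℝ n f x).map_sum (fun _ j => v j)]
  rw [← sum_comp_letterCount (fun i => tensorTerm f x i v)]
  exact Finset.sum_congr rfl fun r _ => iteratedFDeriv_word hf r v

/-- The multi-indices of total degree at most `N`. -/
def multiIndices (p N : ℕ) : Finset (Fin p → ℕ) :=
  (Finset.range (N + 1)).biUnion fun k => Finset.piAntidiag Finset.univ k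

theorem mem_multiIndices {N : ℕ} {i : Fin p → ℕ} : i ∈ multiIndices p N ↔ ∑ j, i j ≤ N := by
  simp [multiIndices, Finset.mem_piAntidiag]

/-- The coefficient of a multi-index in the Taylor expansion. -/
noncomputable def taylorCoeff (i : Fin p → ℕ) : ℝ :=
  (1 / ((∑ j, i j).factorial : ℝ)) * Nat.multinomial Finset.univ i

theorem taylorCoeff_pos (i : Fin p → ℕ) : 0 < taylorCoeff i := by
  have : (0 : ℝ) < Nat.multinomial Finset.univ i := by exact_mod_cast Nat.multinomial_pos _ _
  unfold taylorCoeff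
  positivity

theorem sum_multiIndices (N : ℕ) (G : (Fin p → ℕ) → ℝ) :
    ∑ i ∈ multiIndices p N, G i = ∑ k ∈ Finset.range (N + 1),
      ∑ i ∈ Finset.piAntidiag (Finset.univ : Finset (Fin p)) k, G i := by
  refine Finset.sum_biUnion fun k _ l _ hkl => ?_
  rw [Function.onFun, Finset.disjoint_left]
  intro i hi hi'
  rw [Finset.mem_piAntidiag] at hi hi'
  exact hkl (hi.1.symm.trans hi'.1)

theorem taylorPoly_sum_eq {N : ℕ} (hf : ContDiff ℝ (N : WithTop ℕ∞) f) (v : Fin p → Space d) :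
    taylorPoly f x N (∑ j, v j)
      = ∑ i ∈ multiIndices p N, taylorCoeff i * tensorTerm f x i v := by
  rw [sum_multiIndices, taylorPoly]
  refine Finset.sum_congr rfl fun k hk => ?_
  rw [iteratedFDeriv_sum_eq (hf.of_le (by exact_mod_cast Nat.lt_succ_iff.1 (Finset.mem_range.1 hk))),
    Finset.mul_sum]
  refine Finset.sum_congr rfl fun i hi => ?_
  rw [taylorCoeff, (Finset.mem_piAntidiag.1 hi).1, mul_assoc]

/-- Every denominator in the weight is at most 2p. Hence the Taylor polynomial of order 2p contains
all multi-indices of weight at most 1. -/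
theorem sum_le_of_weight_le_one {i : Fin p → ℕ} (hw : weight i ≤ 1) : ∑ j, i j ≤ 2 * p := by
  rcases Nat.eq_zero_or_pos p with rfl | hp
  · simp
  have hp' : (0 : ℚ) < p := by exact_mod_cast hp
  have h : (∑ j, (i j : ℚ)) / (2 * p) ≤ weight i := by
    rw [weight, Finset.sum_div]
    refine Finset.sum_le_sum fun j _ => ?_
    have : (j : ℚ) + 1 ≤ p := by exact_mod_cast j.2
    have hj : (0 : ℚ) ≤ j := by positivity
    gcongr
  have h2 := h.trans hw
  rw [div_le_one (by positivity)] at h2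
  exact_mod_cast h2

theorem two_le_sum_of_weight_eq_one {i : Fin p → ℕ} (hw : weight i = 1) : 2 ≤ ∑ j, i j := by
  have h : weight i ≤ (∑ j, (i j : ℚ)) / 2 := by
    rw [weight, Finset.sum_div]
    refine Finset.sum_le_sum fun j _ => ?_
    have hj : (0 : ℚ) ≤ j := by positivity
    gcongr
    linarith
  rw [hw, le_div_iff₀ (by norm_num)] at h
  have : (2 : ℚ) ≤ ((∑ j, i j : ℕ) : ℚ) := by push_cast; linarith
  exact_mod_cast this

/-- Weight 1 forces a total degree of at least 2, so the lower bound on k can be dropped. -/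
theorem limitG_eq (B : Space d ≃ₗᵢ[ℝ] Space d) (h : Space d) :
    limitG f x p B h = ∑ i ∈ (multiIndices p (2 * p)).filter (fun i => weight i = 1),
      taylorCoeff i * tensorTerm f x i (fun j => (subE f x p j).starProjection (B h)) := by
  rw [limitG, Finset.sum_filter, sum_multiIndices]
  have hsub : Finset.Icc 2 (2 * p) ⊆ Finset.range (2 * p + 1) := fun k hk => by
    simp only [Finset.mem_Icc, Finset.mem_range] at *; omega
  rw [← Finset.sum_subset hsub]
  · refine Finset.sum_congr rfl fun k _ => ?_
    rw [← Finset.sum_filter, Finset.mul_sum]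
    refine Finset.sum_congr rfl fun i hi => ?_
    rw [taylorCoeff, (Finset.mem_piAntidiag.1 (Finset.mem_filter.1 hi).1).1, mul_assoc]
  · intro k hk hk'
    refine Finset.sum_eq_zero fun i hi => if_neg fun hw => ?_
    have h1 := two_le_sum_of_weight_eq_one hw
    rw [(Finset.mem_piAntidiag.1 hi).1] at h1
    simp only [Finset.mem_Icc, Finset.mem_range] at hk hk'
    omega

end TensorTerm

/-! ### The spaces F and E, and adapted coordinates -/

section Subspaces

variable {d p : ℕ} {f : Space d → ℝ} {x : Space d}

theorem subF_succ_le (k : ℕ) : subF f x (k + 1) ≤ subF f x k := fun _ h => h.1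

theorem subF_antitone : Antitone (subF f x) := antitone_nat_of_succ_le subF_succ_le

theorem mem_subF_succ_iff {k : ℕ} {h : Space d} :
    h ∈ subF f x (k + 1) ↔ h ∈ subF f x k ∧ ∀ h' ∈ subF f x k,
      iteratedFDeriv ℝ (2 * k + 2) f x (Fin.cons h (fun _ : Fin (2 * k + 1) => h')) = 0 :=
  Iff.rfl

/-- The definition of F_{k+1} tests only equal vectors h'; polarization in the remaining 2k + 1
slots allows distinct ones. -/
theorem iteratedFDeriv_cons_eq_zero {k : ℕ}
    (hf : ContDiff ℝ ((2 * k + 2 : ℕ) : WithTop ℕ∞) f) {u : Space d} (hu : u ∈ subF f x (k + 1))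
    (b : Fin (2 * k + 1) → Space d) (hb : ∀ l, b l ∈ subF f x k) :
    iteratedFDeriv ℝ (2 * k + 2) f x (Fin.cons u b) = 0 := by
  refine eq_zero_of_diagonal_eq_zero
    ((iteratedFDeriv ℝ (2 * k + 2) f x).curryLeft u).toMultilinearMap (fun v σ => ?_) b
    (fun s => ?_)
  · change iteratedFDeriv ℝ (2 * k + 1 + 1) f x (Fin.cons u (v ∘ σ))
      = iteratedFDeriv ℝ (2 * k + 1 + 1) f x (Fin.cons u v)
    have hf' : ContDiff ℝ ((2 * k + 1 : ℕ) : WithTop ℕ∞) f :=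
      hf.of_le (by exact_mod_cast Nat.le_succ _)
    rw [← fderiv_iteratedFDeriv_apply hf, ← fderiv_iteratedFDeriv_apply hf]
    congr 2
    funext y
    exact iteratedFDeriv_comp_perm hf' y v σ
  · exact hu.2 _ (Submodule.sum_mem _ fun j _ => Submodule.smul_mem _ _ (hb j))

/-- `∇^{2k}f(x)` vanishes on vectors of `F_{k-1}` as soon as one of them lies in `F_k`. -/
theorem iteratedFDeriv_eq_zero_of_mem_subF {k : ℕ}
    (hf : ContDiff ℝ ((2 * k + 2 : ℕ) : WithTop ℕ∞) f) (b : Fin (2 * k + 2) → Space d)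
    (hb : ∀ l, b l ∈ subF f x k) (l : Fin (2 * k + 2)) (hl : b l ∈ subF f x (k + 1)) :
    iteratedFDeriv ℝ (2 * k + 2) f x b = 0 := by
  rw [← iteratedFDeriv_comp_perm hf x b (Equiv.swap 0 l),
    ← Fin.cons_self_tail (b ∘ Equiv.swap 0 l)]
  refine iteratedFDeriv_cons_eq_zero hf (by simpa using hl) _ fun _ => hb _

theorem subE_le_subF (j : Fin p) : subE f x p j ≤ subF f x j := by
  unfold subE
  split_ifs
  · exact inf_le_left
  · exact le_rfl

/-- `E_l` sits inside F_{j+1}, to which `E_j` is orthogonal by construction. -/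
theorem subE_le_orthogonal {j l : Fin p} (hjl : j < l) :
    subE f x p l ≤ (subE f x p j)ᗮ := by
  have hj : (j : ℕ) + 1 < p := lt_of_le_of_lt (Nat.succ_le_of_lt hjl) l.2
  have h1 : subE f x p l ≤ subF f x (j + 1) :=
    (subE_le_subF l).trans (subF_antitone (Nat.succ_le_of_lt hjl))
  refine h1.trans ?_
  rw [subE, if_pos hj]
  exact (Submodule.le_orthogonal_orthogonal _).trans (Submodule.orthogonal_le inf_le_right)

theorem subE_le_orthogonal_of_ne {j l : Fin p} (hjl : j ≠ l) :
    subE f x p l ≤ (subE f x p j)ᗮ := by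
  rcases lt_or_gt_of_ne hjl with h | h
  · exact subE_le_orthogonal h
  · exact (Submodule.le_orthogonal_orthogonal _).trans
      (Submodule.orthogonal_le (subE_le_orthogonal h))

/-- The dimensions telescope: each `E` but the last complements one F in the preceding one, and the
last is the remaining F. -/
theorem sum_finrank_subE (hp : 1 ≤ p) :
    ∑ j : Fin p, Module.finrank ℝ (subE f x p j) = d := by
  have key : ∀ n : ℕ, ∑ k ∈ Finset.range n,
      Module.finrank ℝ (subF f x k ⊓ (subF f x (k + 1))ᗮ : Submodule ℝ (Space d))
        + Module.finrank ℝ (subF f x n) = d := by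
    intro n
    induction n with
    | zero =>
      rw [Finset.range_zero, Finset.sum_empty, zero_add]
      exact (finrank_top ℝ (Space d)).trans finrank_euclideanSpace_fin
    | succ n ih =>
      have := Submodule.finrank_add_inf_finrank_orthogonal (subF_succ_le (f := f) (x := x) n)
      rw [inf_comm] at this
      rw [Finset.sum_range_succ]
      omega
  obtain ⟨n, rfl⟩ : ∃ n, p = n + 1 := ⟨p - 1, by omega⟩
  rw [Fin.sum_univ_castSucc]
  refine Eq.trans ?_ (key n)
  rw [Finset.sum_range]
  congr 1
  · refine Finset.sum_congr rfl fun j _ => ?_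
    rw [subE, if_pos (by simp)]
    rfl
  · rw [subE, if_neg (by simp)]
    rfl

theorem exists_mem_block {E : Fin p → Submodule ℝ (Space d)}
    (hE : ∑ j, Module.finrank ℝ (E j) = d) (i : Fin d) : ∃ j, i ∈ block E j := by
  have hp : 0 < p := by
    rcases Nat.eq_zero_or_pos p with rfl | h
    · have := i.2
      simp at hE
      omega
    · exact h
  set S := Finset.univ.filter
    (fun j : Fin p => (i : ℕ) < ∑ l ∈ Finset.Iic j, Module.finrank ℝ (E l))
  have hS : S.Nonempty := by
    refine ⟨⟨p - 1, by omega⟩, Finset.mem_filter.2 ⟨Finset.mem_univ _, ?_⟩⟩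
    have : Finset.Iic (⟨p - 1, by omega⟩ : Fin p) = Finset.univ := by
      ext l
      simp only [Finset.mem_Iic, Finset.mem_univ, iff_true, Fin.le_def]
      omega
    rw [this, hE]
    exact i.2
  -- The block of i is the first one whose cumulative dimension exceeds i.
  refine ⟨S.min' hS, Finset.mem_filter.2 ⟨Finset.mem_univ _, ?_,
    (Finset.mem_filter.1 (S.min'_mem hS)).2⟩⟩
  by_contra! hlt
  rcases Nat.eq_zero_or_pos (S.min' hS : ℕ) with h0 | h0
  · have : Finset.Iio (S.min' hS) = ∅ := by
      ext l
      simp only [Finset.mem_Iio, Fin.lt_def, h0, Finset.notMem_empty, iff_false]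
      omega
    rw [this, Finset.sum_empty] at hlt
    omega
  · set j' : Fin p := ⟨(S.min' hS : ℕ) - 1, by omega⟩
    have h1 : Finset.Iio (S.min' hS) = Finset.Iic j' := by
      ext l
      simp only [Finset.mem_Iio, Finset.mem_Iic, Fin.lt_def, Fin.le_def, j']
      omega
    rw [h1] at hlt
    have h2 := S.min'_le j' (Finset.mem_filter.2 ⟨Finset.mem_univ _, hlt⟩)
    simp only [Fin.le_def, j'] at h2
    omega

theorem block_unique {E : Fin p → Submodule ℝ (Space d)} {i : Fin d} {j l : Fin p}
    (hj : i ∈ block E j) (hl : i ∈ block E l) : j = l := by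
  have key : ∀ j l : Fin p, i ∈ block E j → i ∈ block E l → ¬ j < l := by
    intro j l hj hl hjl
    have h1 := (Finset.mem_filter.1 hj).2.2
    have h2 := (Finset.mem_filter.1 hl).2.1
    have h3 : ∑ l ∈ Finset.Iic j, Module.finrank ℝ (E l)
        ≤ ∑ l ∈ Finset.Iio l, Module.finrank ℝ (E l) :=
      Finset.sum_le_sum_of_subset fun a ha =>
        Finset.mem_Iio.2 (lt_of_le_of_lt (Finset.mem_Iic.1 ha) hjl)
    omega
  exact le_antisymm (not_lt.1 (key l j hl hj)) (not_lt.1 (key j l hj hl))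

theorem exists_blockIndex {E : Fin p → Submodule ℝ (Space d)}
    (hE : ∑ j, Module.finrank ℝ (E j) = d) :
    ∃ κ : Fin d → Fin p, ∀ i j, i ∈ block E j ↔ κ i = j := by
  choose κ hκ using exists_mem_block hE
  exact ⟨κ, fun i j => ⟨fun h => block_unique (hκ i) h, fun h => h ▸ hκ i⟩⟩

theorem exponent_eq {E : Fin p → Submodule ℝ (Space d)} {κ : Fin d → Fin p}
    (hκ : ∀ i j, i ∈ block E j ↔ κ i = j) (i : Fin d) :
    exponent E i = 1 / (2 * ((κ i : ℝ) + 1)) := by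
  simp [exponent, hκ]

variable {B : Space d ≃ₗᵢ[ℝ] Space d} {κ : Fin d → Fin p}

theorem starProjection_adapted_single (hB : IsAdapted B (subE f x p))
    (hκ : ∀ i j, i ∈ block (subE f x p) j ↔ κ i = j) (i : Fin d) (j : Fin p) :
    (subE f x p j).starProjection (B (EuclideanSpace.single i 1))
      = if κ i = j then B (EuclideanSpace.single i 1) else 0 := by
  have hmem := hB (κ i) i ((hκ i _).2 rfl)
  split_ifs with h
  · exact Submodule.starProjection_eq_self_iff.2 (h ▸ hmem)
  · rw [Submodule.starProjection_apply_eq_zero_iff]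
    exact subE_le_orthogonal_of_ne (Ne.symm h) hmem

theorem isometry_eq_sum (B : Space d ≃ₗᵢ[ℝ] Space d) (h : Space d) :
    B h = ∑ i, h i • B (EuclideanSpace.single i 1) := by
  conv_lhs => rw [← (EuclideanSpace.basisFun (Fin d) ℝ).sum_repr h]
  simp

theorem starProjection_adapted (hB : IsAdapted B (subE f x p))
    (hκ : ∀ i j, i ∈ block (subE f x p) j ↔ κ i = j) (h : Space d) (j : Fin p) :
    (subE f x p j).starProjection (B h)
      = ∑ i, if κ i = j then h i • B (EuclideanSpace.single i 1) else 0 := by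
  rw [isometry_eq_sum B h, map_sum]
  refine Finset.sum_congr rfl fun i _ => ?_
  rw [map_smul, starProjection_adapted_single hB hκ]
  split_ifs <;> simp

theorem sum_starProjection_adapted (hB : IsAdapted B (subE f x p))
    (hκ : ∀ i j, i ∈ block (subE f x p) j ↔ κ i = j) (h : Space d) :
    ∑ j, (subE f x p j).starProjection (B h) = B h := by
  rw [Finset.sum_congr rfl fun j _ => starProjection_adapted hB hκ h j, Finset.sum_comm,
    isometry_eq_sum B h]
  simp

theorem norm_starProjection_adapted_le (hB : IsAdapted B (subE f x p))
    (hκ : ∀ i j, i ∈ block (subE f x p) j ↔ κ i = j) (h : Space d) (j : Fin p) :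
    ‖(subE f x p j).starProjection (B h)‖ ≤ ∑ i, if κ i = j then |h i| else 0 := by
  rw [starProjection_adapted hB hκ]
  refine (norm_sum_le _ _).trans (Finset.sum_le_sum fun i _ => ?_)
  split_ifs <;> simp [norm_smul]

theorem hadamard_powVec_apply (t : ℝ) (α : Fin d → ℝ) (h : Space d) (i : Fin d) :
    hadamard (powVec t α) h i = t ^ α i * h i := rfl

/-- The exponent is constant on each block, so on `E_j` the anisotropic scaling acts as a single
scalar. -/
theorem starProjection_adapted_scale (hB : IsAdapted B (subE f x p))
    (hκ : ∀ i j, i ∈ block (subE f x p) j ↔ κ i = j) (t : ℝ) (h : Space d) (j : Fin p) :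
    (subE f x p j).starProjection (B (hadamard (powVec t (exponent (subE f x p))) h))
      = t ^ (1 / (2 * ((j : ℝ) + 1))) • (subE f x p j).starProjection (B h) := by
  rw [starProjection_adapted hB hκ, starProjection_adapted hB hκ, Finset.smul_sum]
  refine Finset.sum_congr rfl fun i _ => ?_
  split_ifs with hi
  · rw [hadamard_powVec_apply, exponent_eq hκ, hi, mul_smul]
  · simp

end Subspaces

/-! ### Vanishing of the terms of weight below 1 -/

section Vanishing

variable {d p : ℕ} {f : Space d → ℝ} {x : Space d}

theorem exists_word {n : ℕ} {i : Fin p → ℕ} (hi : ∑ j, i j = n) :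
    ∃ r : Fin n → Fin p, letterCount r = i := by
  subst hi
  exact ⟨_, letterCount_sigma i⟩

/-- Write K = ∑ m. Since the j-th vector lies in F_j, the conclusion puts every vector that occurs
in F_{K-1} and one of them in F_K, which makes ∇^{2K} f vanish on them. The check is finite and
breaks at p = 5: m_1 = 1, m_4 = 2 (from 0) has weight 9/10, but K = 3 exceeds 1 + 1. -/
theorem support_of_small_weight (hp : p ≤ 4) {m : Fin p → ℕ}
    (hw : weight (fun j => 2 * m j) < 1) :
    (∀ j, m j ≠ 0 → ∑ l, m l ≤ j + 1) ∧
      (∑ l, m l ≠ 0 → ∃ j, m j ≠ 0 ∧ ∑ l, m l ≤ j) := by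
  have hw' : ∑ j : Fin p, (m j : ℚ) / ((j : ℚ) + 1) < 1 := by
    refine lt_of_eq_of_lt (Finset.sum_congr rfl fun j _ => ?_) hw
    push_cast
    rw [mul_div_mul_left _ _ two_ne_zero]
  interval_cases p
  · simp
  · norm_num [Fin.sum_univ_succ, Fin.forall_fin_succ, Fin.exists_fin_succ] at hw' ⊢
    omega
  · norm_num [Fin.sum_univ_succ, Fin.forall_fin_succ, Fin.exists_fin_succ] at hw' ⊢
    have h : 2 * m 0 + m 1 < 2 := by
      have : (2 * m 0 + m 1 : ℚ) < 2 := by linarith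
      exact_mod_cast this
    omega
  · norm_num [Fin.sum_univ_succ, Fin.forall_fin_succ, Fin.exists_fin_succ] at hw' ⊢
    have h : 6 * m 0 + 3 * m 1 + 2 * m 2 < 6 := by
      have : (6 * m 0 + 3 * m 1 + 2 * m 2 : ℚ) < 6 := by linarith
      exact_mod_cast this
    omega
  · norm_num [Fin.sum_univ_succ, Fin.forall_fin_succ, Fin.exists_fin_succ] at hw' ⊢
    rw [show (Fin.succ 2 : Fin 4) = 3 from rfl] at *
    have h : 12 * m 0 + 6 * m 1 + 4 * m 2 + 3 * m 3 < 12 := by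
      have : (12 * m 0 + 6 * m 1 + 4 * m 2 + 3 * m 3 : ℚ) < 12 := by
        linarith
      exact_mod_cast this
    omega

/-- For `p ≤ 4`, the terms with even exponents and weight less than `1` vanish. -/
theorem tensorTerm_even_eq_zero (hp : p ≤ 4) (hf : ContDiff ℝ ((2 * p : ℕ) : WithTop ℕ∞) f)
    (hf0 : f x = 0) {v : Fin p → Space d} (hv : ∀ j : Fin p, v j ∈ subF f x j) {i : Fin p → ℕ}
    (hi : ∀ j, Even (i j)) (hw : weight i < 1) : tensorTerm f x i v = 0 := by
  choose m hm using fun j => (hi j).exists_two_nsmul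
  obtain rfl : i = fun j => 2 * m j := funext fun j => by rw [hm j, smul_eq_mul]
  obtain ⟨h1, h2⟩ := support_of_small_weight hp hw
  have hle := sum_le_of_weight_le_one hw.le
  rw [← Finset.mul_sum] at hle
  rcases hk : ∑ l, m l with _ | k
  · obtain ⟨r, hr⟩ := exists_word (n := 0) (i := fun j => 2 * m j)
      (by rw [← Finset.mul_sum, hk, mul_zero])
    rw [← hr, ← iteratedFDeriv_word (hf.of_le (by exact_mod_cast Nat.zero_le _)) r v]
    simpa using hf0
  · rw [hk] at h1 h2 hle
    obtain ⟨r, hr⟩ := exists_word (n := 2 * k + 2) (i := fun j => 2 * m j)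
      (by rw [← Finset.mul_sum, hk]; ring)
    have hfk : ContDiff ℝ ((2 * k + 2 : ℕ) : WithTop ℕ∞) f :=
      hf.of_le (by exact_mod_cast (show 2 * k + 2 ≤ 2 * p by omega))
    rw [← hr, ← iteratedFDeriv_word hfk r v]
    have hne : ∀ l, m (r l) ≠ 0 := by
      intro l h0
      have h3 : letterCount r (r l) = 0 := by rw [hr]; simp [h0]
      rw [letterCount, Finset.card_eq_zero] at h3
      exact Finset.notMem_empty l (h3 ▸ Finset.mem_filter.2 ⟨Finset.mem_univ _, rfl⟩)
    obtain ⟨j, hj, hkj⟩ := h2 (Nat.succ_ne_zero k)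
    have hpos : 0 < letterCount r j := by rw [hr]; dsimp only; omega
    obtain ⟨l, hl⟩ := Finset.card_pos.1 hpos
    have hlj : r l = j := (Finset.mem_filter.1 hl).2
    refine iteratedFDeriv_eq_zero_of_mem_subF hfk _ (fun l => ?_) l ?_
    · exact subF_antitone (by have := h1 _ (hne l); omega) (hv (r l))
    · rw [hlj]
      exact subF_antitone hkj (hv j)

/-- A nonnegative polynomial function without monomials with only even exponents vanishes. -/
theorem coeff_eq_zero_of_nonneg {ι : Type*} [Fintype ι] [DecidableEq ι] (S : Finset (ι → ℕ))
    (a : (ι → ℕ) → ℝ) (hnonneg : ∀ s : ι → ℝ, 0 ≤ ∑ i ∈ S, a i * ∏ j, s j ^ i j)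
    (heven : ∀ i ∈ S, (∀ j, Even (i j)) → a i = 0) {i : ι → ℕ} (hi : i ∈ S) : a i = 0 := by
  have hzero : ∀ s : ι → ℝ, ∑ i ∈ S, a i * ∏ j, s j ^ i j = 0 := by
    intro s
    -- Sum over all sign changes of s: an odd exponent i_j contributes the factor 1 + (-1)^(i_j) =
    -- 0, and the even monomials have zero coefficient.
    have hsum : ∑ ε ∈ Fintype.piFinset (fun _ : ι => ({1, -1} : Finset ℝ)),
        ∑ i ∈ S, a i * ∏ j, (ε j * s j) ^ i j = 0 := by
      rw [Finset.sum_comm]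
      refine Finset.sum_eq_zero fun i hi => ?_
      by_cases hev : ∀ j, Even (i j)
      · simp [heven i hi hev]
      · push Not at hev
        obtain ⟨j, hj⟩ := hev
        rw [← Finset.mul_sum]
        simp only [mul_pow, Finset.prod_mul_distrib]
        rw [← Finset.sum_mul, ← Finset.prod_univ_sum (fun _ : ι => ({1, -1} : Finset ℝ))
          (fun j e => e ^ i j), Finset.prod_eq_zero (Finset.mem_univ j), zero_mul, mul_zero]
        rw [Finset.sum_pair (by norm_num), (Nat.not_even_iff_odd.1 hj).neg_one_pow]
        simp
    -- Nonnegative values with zero sum all vanish; the trivial sign change gives the value at s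
    -- itself.
    have h1 := (Finset.sum_eq_zero_iff_of_nonneg fun ε _ => hnonneg fun j => ε j * s j).1 hsum
      (fun _ => 1) (by simp)
    simpa using h1
  have := coeff_eq_zero_of_sum_eq_zero S a (fun i => i) hzero i
  rwa [Finset.sum_filter, Finset.sum_ite_eq', if_pos hi] at this

theorem prod_rpow_eq_rpow_weight {t : ℝ} (ht : 0 ≤ t) (i : Fin p → ℕ) :
    ∏ j : Fin p, (t ^ (1 / (2 * (((j : ℕ) : ℝ) + 1)))) ^ i j = t ^ ((weight i : ℚ) : ℝ) := by
  have : ((weight i : ℚ) : ℝ) = ∑ j : Fin p, 1 / (2 * (((j : ℕ) : ℝ) + 1)) * (i j : ℝ) := by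
    rw [weight, Rat.cast_sum]
    refine Finset.sum_congr rfl fun j _ => ?_
    push_cast
    rw [div_eq_mul_one_div, mul_comm]
  rw [this, Real.rpow_sum_of_nonneg ht fun j _ => by positivity]
  exact Finset.prod_congr rfl fun j _ => by rw [Real.rpow_mul ht, Real.rpow_natCast]

theorem tendsto_rpow_zero_nhdsGT {a : ℝ} (ha : 0 < a) :
    Tendsto (fun t : ℝ => t ^ a) (𝓝[>] 0) (𝓝 0) := by
  have := (Real.continuousAt_rpow_const 0 a (Or.inr ha.le)).tendsto
  rw [Real.zero_rpow ha.ne'] at this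
  exact this.mono_left nhdsWithin_le_nhds

/-- The remainder of the Taylor expansion along a quasi-homogeneous curve is `o(t)`. -/
theorem taylor_remainder_isLittleO (hp : 1 ≤ p)
    (hf : ContDiff ℝ ((2 * p : ℕ) : WithTop ℕ∞) f) (v : Fin p → Space d) :
    (fun t : ℝ => f (x + ∑ j : Fin p, t ^ (1 / (2 * (((j : ℕ) : ℝ) + 1))) • v j)
      - ∑ i ∈ multiIndices p (2 * p), taylorCoeff i * tensorTerm f x i v *
        t ^ ((weight i : ℚ) : ℝ)) =o[𝓝[>] 0] fun t => t := by
  set y : ℝ → Space d := fun t => ∑ j : Fin p, t ^ (1 / (2 * (((j : ℕ) : ℝ) + 1))) • v j with hy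
  have hp0 : (0 : ℝ) < p := by exact_mod_cast hp
  have hlim : Tendsto y (𝓝[>] 0) (𝓝 0) := by
    have : Tendsto y (𝓝[>] 0) (𝓝 (∑ j : Fin p, (0 : ℝ) • v j)) :=
      tendsto_finsetSum _ fun j _ =>
        (tendsto_rpow_zero_nhdsGT (by positivity)).smul_const (v j)
    simpa using this
  have hO : (fun t => ‖y t‖ ^ (2 * p)) =O[𝓝[>] 0] fun t : ℝ => t := by
    refine Asymptotics.IsBigO.of_bound ((∑ j, ‖v j‖) ^ (2 * p)) ?_
    filter_upwards [Ioo_mem_nhdsGT (zero_lt_one' ℝ)] with t ht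
    -- For t < 1 every scale is at most t^(1/(2p)), the scale of the last block.
    have h1 : ‖y t‖ ≤ t ^ (1 / (2 * (p : ℝ))) * ∑ j, ‖v j‖ := by
      rw [Finset.mul_sum]
      refine (norm_sum_le _ _).trans (Finset.sum_le_sum fun j _ => ?_)
      rw [norm_smul, Real.norm_of_nonneg (Real.rpow_nonneg ht.1.le _)]
      refine mul_le_mul_of_nonneg_right ?_ (norm_nonneg _)
      refine Real.rpow_le_rpow_of_exponent_ge ht.1 ht.2.le ?_
      have : ((j : ℕ) : ℝ) + 1 ≤ p := by exact_mod_cast j.2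
      gcongr
    rw [Real.norm_of_nonneg (by positivity), Real.norm_of_nonneg ht.1.le]
    calc ‖y t‖ ^ (2 * p) ≤ (t ^ (1 / (2 * (p : ℝ))) * ∑ j, ‖v j‖) ^ (2 * p) := by gcongr
      _ = (∑ j, ‖v j‖) ^ (2 * p) * t := by
        rw [mul_pow, ← Real.rpow_natCast, ← Real.rpow_mul ht.1.le, mul_comm]
        push_cast
        rw [one_div, inv_mul_cancel₀ (by positivity), Real.rpow_one]
  have h := ((taylorPoly_isLittleO (by omega) hf x).comp_tendsto hlim).trans_isBigO hO
  refine h.congr' ?_ EventuallyEq.rfl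
  filter_upwards [self_mem_nhdsWithin] with t ht
  simp only [Function.comp_apply, hy]
  rw [taylorPoly_sum_eq hf]
  congr 1
  refine Finset.sum_congr rfl fun i _ => ?_
  rw [tensorTerm_smul, prod_rpow_eq_rpow_weight (le_of_lt ht)]
  ring

/-- At a minimum, all the terms of weight less than `1` vanish if those with even exponents do. -/
theorem tensorTerm_eq_zero_of_weight_lt_one (hp : 1 ≤ p)
    (hf : ContDiff ℝ ((2 * p : ℕ) : WithTop ℕ∞) f) (hmin : ∀ᶠ y in 𝓝 x, 0 ≤ f y)
    {v : Fin p → Space d}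
    (heven : ∀ i : Fin p → ℕ, (∀ j, Even (i j)) → weight i < 1 → tensorTerm f x i v = 0)
    {i : Fin p → ℕ} (hi : weight i < 1) : tensorTerm f x i v = 0 := by
  by_contra hne
  set S := (multiIndices p (2 * p)).filter
    (fun i => weight i < 1 ∧ tensorTerm f x i v ≠ 0) with hS
  have hmem : ∀ {k : Fin p → ℕ}, weight k < 1 → tensorTerm f x k v ≠ 0 → k ∈ S := by
    intro k h1 h2
    exact Finset.mem_filter.2
      ⟨mem_multiIndices.2 (sum_le_of_weight_le_one h1.le), h1, h2⟩
  obtain ⟨k, hkS, hkmin⟩ := S.exists_min_image weight ⟨i, hmem hi hne⟩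
  obtain ⟨hk1, hk2, hk3⟩ := Finset.mem_filter.1 hkS
  set w : ℝ := ((weight k : ℚ) : ℝ) with hw
  have hw1 : w < 1 := by rw [hw]; exact_mod_cast hk2
  -- With w the lowest weight of a nonzero term, this polynomial in the amplitudes s is the limit of
  -- f(x + y(t)) / t^w, where y follows the directions s_j v_j.
  have hnonneg : ∀ s : Fin p → ℝ, 0 ≤ ∑ i ∈ (multiIndices p (2 * p)).filter
      (fun i => weight i = weight k), taylorCoeff i * tensorTerm f x i v * ∏ j, s j ^ i j := by
    intro s
    set y : ℝ → Space d :=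
      fun t => ∑ j : Fin p, t ^ (1 / (2 * (((j : ℕ) : ℝ) + 1))) • (s j • v j) with hy
    have hlim : Tendsto (fun t => x + y t) (𝓝[>] 0) (𝓝 x) := by
      have : Tendsto y (𝓝[>] 0) (𝓝 (∑ j : Fin p, (0 : ℝ) • (s j • v j))) :=
        tendsto_finsetSum _ fun j _ =>
          (tendsto_rpow_zero_nhdsGT (by positivity)).smul_const (s j • v j)
      simpa using this.const_add x
    have hrem := taylor_remainder_isLittleO (x := x) hp hf (fun j => s j • v j)
    have hrem' : Tendsto (fun t : ℝ => (f (x + y t)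
        - ∑ i ∈ multiIndices p (2 * p), taylorCoeff i * tensorTerm f x i (fun j => s j • v j) *
        t ^ ((weight i : ℚ) : ℝ)) / t * t ^ (1 - w)) (𝓝[>] 0) (𝓝 0) := by
      have h := hrem.tendsto_div_nhds_zero.mul (tendsto_rpow_zero_nhdsGT (sub_pos.2 hw1))
      rwa [zero_mul] at h
    -- After division by t^w, terms of lower weight vanish by minimality of `k`, and terms of higher
    -- weight tend to 0.
    have hsum : Tendsto (fun t : ℝ => ∑ i ∈ multiIndices p (2 * p), taylorCoeff i *
        tensorTerm f x i (fun j => s j • v j) * t ^ (((weight i : ℚ) : ℝ) - w)) (𝓝[>] 0)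
        (𝓝 (∑ i ∈ multiIndices p (2 * p), if weight i = weight k then
          taylorCoeff i * tensorTerm f x i v * ∏ j, s j ^ i j else 0)) := by
      refine tendsto_finsetSum _ fun i hiI => ?_
      split_ifs with h
      · rw [hw, h, sub_self]
        simp only [Real.rpow_zero, mul_one, tensorTerm_smul]
        refine tendsto_const_nhds.congr fun t => ?_
        ring
      · rcases lt_or_gt_of_ne h with h | h
        · have h0 : tensorTerm f x i v = 0 := by
            by_contra h0
            exact absurd (hkmin i (hmem (h.trans hk2) h0)) (not_le.2 h)
          simp [tensorTerm_smul, h0]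
        · have hpos : 0 < ((weight i : ℚ) : ℝ) - w := by
            rw [hw, sub_pos]
            exact_mod_cast h
          simpa using (tendsto_rpow_zero_nhdsGT hpos).const_mul
            (taylorCoeff i * tensorTerm f x i (fun j => s j • v j))
    rw [Finset.sum_filter]
    refine ge_of_tendsto (by simpa using hrem'.add hsum) ?_
    filter_upwards [hlim.eventually hmin, self_mem_nhdsWithin] with t ht ht0
    have ht0 : (0 : ℝ) < t := ht0
    have heq : (f (x + y t)
        - ∑ i ∈ multiIndices p (2 * p), taylorCoeff i * tensorTerm f x i (fun j => s j • v j) *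
        t ^ ((weight i : ℚ) : ℝ)) / t * t ^ (1 - w) + ∑ i ∈ multiIndices p (2 * p), taylorCoeff i *
        tensorTerm f x i (fun j => s j • v j) * t ^ (((weight i : ℚ) : ℝ) - w)
        = f (x + y t) / t ^ w := by
      simp only [Real.rpow_sub ht0, Real.rpow_one, ← mul_div_assoc]
      rw [← Finset.sum_div]
      have := (Real.rpow_pos_of_pos ht0 w).ne'
      field_simp
      ring
    rw [heq]
    exact div_nonneg ht (Real.rpow_nonneg ht0.le _)
  have h0 := coeff_eq_zero_of_nonneg _ (fun i => taylorCoeff i * tensorTerm f x i v) hnonneg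
    (fun i hi hev => by
      rw [heven i hev ((Finset.mem_filter.1 hi).2 ▸ hk2), mul_zero])
    (Finset.mem_filter.2 ⟨hk1, rfl⟩)
  exact (mul_ne_zero (taylorCoeff_pos k).ne' hk3) h0

/-- All the terms of weight less than `1` of the Taylor expansion at a strict polynomial minimum
vanish. -/
theorem tensorTerm_starProjection_eq_zero (hmin : IsStrictPolynomialMin f x p)
    (hf0 : f x = 0) (heven : 5 ≤ p → EvenTermsVanish f x p) (h : Space d)
    {i : Fin p → ℕ} (hi : weight i < 1) :
    tensorTerm f x i (fun j => (subE f x p j).starProjection h) = 0 := by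
  refine tensorTerm_eq_zero_of_weight_lt_one hmin.isLeast.1.1 hmin.contDiff
    (by simpa [IsLocalMin, IsMinFilter, hf0] using hmin.isLocalMin) (fun i hev hw => ?_) hi
  rcases Nat.lt_or_ge p 5 with hp | hp
  · exact tensorTerm_even_eq_zero (by omega) hmin.contDiff hf0
      (fun j => subE_le_subF j (Submodule.starProjection_apply_mem _ _)) hev hw
  · refine heven hp h i (fun j => ⟨hev j, ?_⟩) hw
    exact (Finset.single_le_sum (fun _ _ => Nat.zero_le _) (Finset.mem_univ j)).trans
      (sum_le_of_weight_le_one hw.le)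

end Vanishing

/-! ### The quasi-homogeneous gauge -/

section AnisotropicNorm

variable {d p : ℕ} (κ : Fin d → Fin p)

/-- The quasi-homogeneous gauge `∑ i, h_i ^ (2 (κ i + 1))`. -/
noncomputable def gauge (h : Space d) : ℝ := ∑ i, (h i) ^ (2 * ((κ i : ℕ) + 1))

theorem gauge_term_nonneg (h : Space d) (i : Fin d) : 0 ≤ (h i) ^ (2 * ((κ i : ℕ) + 1)) := by
  rw [pow_mul]; positivity

theorem gauge_nonneg (h : Space d) : 0 ≤ gauge κ h :=
  Finset.sum_nonneg fun i _ => gauge_term_nonneg κ h i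

theorem continuous_gauge : Continuous (gauge κ) := by
  unfold gauge; fun_prop

theorem gauge_zero : gauge κ 0 = 0 := by simp [gauge]

theorem gauge_pos {h : Space d} (hh : h ≠ 0) : 0 < gauge κ h := by
  refine (gauge_nonneg κ h).lt_of_ne' fun h0 => hh ?_
  ext i
  have := (Finset.sum_eq_zero_iff_of_nonneg fun i _ => gauge_term_nonneg κ h i).1 h0 i
    (Finset.mem_univ i)
  simpa using this

theorem gauge_scale {t : ℝ} (ht : 0 ≤ t) {α : Fin d → ℝ}
    (hα : ∀ i, α i = 1 / (2 * ((κ i : ℝ) + 1))) (h : Space d) :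
    gauge κ (hadamard (powVec t α) h) = t * gauge κ h := by
  rw [gauge, gauge, Finset.mul_sum]
  refine Finset.sum_congr rfl fun i _ => ?_
  rw [hadamard_powVec_apply, mul_pow, ← Real.rpow_natCast, ← Real.rpow_mul ht, hα]
  push_cast
  rw [one_div, inv_mul_cancel₀ (by positivity), Real.rpow_one]

theorem abs_apply_le_gauge_rpow (h : Space d) (i : Fin d) :
    |h i| ≤ gauge κ h ^ (1 / (2 * ((κ i : ℝ) + 1))) := by
  have h1 : |h i| ^ (2 * ((κ i : ℕ) + 1)) ≤ gauge κ h := by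
    rw [← abs_pow, abs_of_nonneg (gauge_term_nonneg κ h i)]
    exact Finset.single_le_sum (fun i _ => gauge_term_nonneg κ h i) (Finset.mem_univ i)
  have h2 := Real.rpow_le_rpow (by positivity) h1 (by positivity : 0 ≤ 1 / (2 * ((κ i : ℝ) + 1)))
  rw [← Real.rpow_natCast, ← Real.rpow_mul (abs_nonneg _)] at h2
  push_cast at h2
  rwa [mul_one_div, div_self (by positivity), Real.rpow_one] at h2

/-- Coordinatewise, u - 1 ≤ u^(k+1) for u = h_i². This bounds the level sets of the gauge and
compares e^(-cN) with a Gaussian. -/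
theorem norm_sq_sub_le_gauge (h : Space d) : ‖h‖ ^ 2 - d ≤ gauge κ h := by
  rw [EuclideanSpace.norm_sq_eq, gauge]
  have : (d : ℝ) = ∑ _i : Fin d, (1 : ℝ) := by simp
  rw [this, ← Finset.sum_sub_distrib]
  refine Finset.sum_le_sum fun i _ => ?_
  rw [Real.norm_eq_abs, sq_abs, pow_mul]
  have h0 := sq_nonneg (h i)
  rcases le_total (h i ^ 2) 1 with h1 | h1
  · have : 0 ≤ (h i ^ 2) ^ ((κ i : ℕ) + 1) := by positivity
    linarith
  · have := le_self_pow₀ h1 (Nat.succ_ne_zero (κ i))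
    rw [Nat.succ_eq_add_one] at this
    linarith

theorem tendsto_gauge_zero : Tendsto (gauge κ) (𝓝 0) (𝓝 0) := by
  simpa [gauge_zero] using (continuous_gauge κ).tendsto 0

theorem norm_le_sum_abs (h : Space d) : ‖h‖ ≤ ∑ i, |h i| := by
  conv_lhs => rw [← (EuclideanSpace.basisFun (Fin d) ℝ).sum_repr h]
  refine (norm_sum_le _ _).trans_eq (Finset.sum_congr rfl fun i _ => ?_)
  simp [norm_smul]

/-- Where N < 1, each |h_i| ≤ N^(1/(2(κ i + 1))) is at most N^(1/(2p)). -/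
theorem norm_pow_isBigO_gauge (hp : 0 < p) :
    (fun h : Space d => ‖h‖ ^ (2 * p)) =O[𝓝 0] gauge κ := by
  refine Asymptotics.IsBigO.of_bound ((d : ℝ) ^ (2 * p)) ?_
  filter_upwards [(tendsto_gauge_zero κ).eventually (gt_mem_nhds one_pos)] with h hh
  have hN := gauge_nonneg κ h
  have hp0 : (0 : ℝ) < p := by exact_mod_cast hp
  have h1 : ‖h‖ ≤ d * gauge κ h ^ (1 / (2 * (p : ℝ))) := by
    refine (norm_le_sum_abs h).trans ?_
    refine (Finset.sum_le_sum fun i _ => (abs_apply_le_gauge_rpow κ h i).trans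
      (Real.rpow_le_rpow_of_exponent_ge_of_imp hN hh.le ?_ ?_) :
      _ ≤ ∑ _i : Fin d, gauge κ h ^ (1 / (2 * (p : ℝ)))).trans_eq (by simp)
    · have : (κ i : ℝ) + 1 ≤ p := by exact_mod_cast (κ i).2
      gcongr
    · intro _ h0
      exact absurd h0 (by positivity)
  rw [Real.norm_of_nonneg (by positivity), Real.norm_of_nonneg hN]
  calc ‖h‖ ^ (2 * p) ≤ (d * gauge κ h ^ (1 / (2 * (p : ℝ)))) ^ (2 * p) := by gcongr
    _ = (d : ℝ) ^ (2 * p) * gauge κ h := by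
      rw [mul_pow, ← Real.rpow_natCast (gauge κ h ^ _), ← Real.rpow_mul hN]
      push_cast
      rw [one_div, inv_mul_cancel₀ (by positivity), Real.rpow_one]

theorem gauge_rpow_isLittleO {w : ℝ} (hw : 1 < w) :
    (fun h : Space d => gauge κ h ^ w) =o[𝓝 0] gauge κ := by
  have h1 : Tendsto (fun h : Space d => gauge κ h ^ (w - 1)) (𝓝 0) (𝓝 0) := by
    have := (tendsto_gauge_zero κ).rpow_const (p := w - 1) (Or.inr (by linarith))
    rwa [Real.zero_rpow (by linarith)] at this
  have h2 := ((Asymptotics.isLittleO_one_iff ℝ).2 h1).mul_isBigO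
    (Asymptotics.isBigO_refl (gauge κ) (𝓝 0))
  refine h2.congr (fun h => ?_) (fun h => one_mul _)
  rcases (gauge_nonneg κ h).eq_or_lt' with h0 | h0
  · rw [h0, Real.zero_rpow (by linarith), Real.zero_rpow (by linarith), mul_zero]
  · rw [Real.rpow_sub_one h0.ne', div_mul_cancel₀ _ h0.ne']

end AnisotropicNorm

/-! ### The quasi-homogeneous limit g -/

section LimitG

variable {d p : ℕ} {f : Space d → ℝ} {x : Space d} {B : Space d ≃ₗᵢ[ℝ] Space d}
  {κ : Fin d → Fin p}

theorem continuous_limitG : Continuous (limitG f x p B) := by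
  have : limitG f x p B = fun h => ∑ i ∈ (multiIndices p (2 * p)).filter (fun i => weight i = 1),
      taylorCoeff i * tensorTerm f x i (fun j => (subE f x p j).starProjection (B h)) :=
    funext (limitG_eq B)
  rw [this]
  refine continuous_finsetSum _ fun i _ => (continuous_const).mul
    (continuous_tensorTerm i fun j => ?_)
  exact ((subE f x p j).starProjection.continuous).comp B.continuous

theorem limitG_zero : limitG f x p B 0 = 0 := by
  rw [limitG_eq]
  refine Finset.sum_eq_zero fun i hi => ?_
  have hw := (Finset.mem_filter.1 hi).2
  obtain ⟨j, hj⟩ : ∃ j, i j ≠ 0 := by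
    by_contra! h
    simp [weight, h] at hw
  rw [tensorTerm_eq_zero_of_eq_zero i _ j hj (by simp), mul_zero]

theorem limitG_scale (hB : IsAdapted B (subE f x p))
    (hκ : ∀ i j, i ∈ block (subE f x p) j ↔ κ i = j) {t : ℝ} (ht : 0 ≤ t) (h : Space d) :
    limitG f x p B (hadamard (powVec t (exponent (subE f x p))) h) = t * limitG f x p B h := by
  rw [limitG_eq, limitG_eq, Finset.mul_sum]
  refine Finset.sum_congr rfl fun i hi => ?_
  simp only [starProjection_adapted_scale hB hκ]
  rw [tensorTerm_smul, prod_rpow_eq_rpow_weight ht, (Finset.mem_filter.1 hi).2]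
  simp only [Rat.cast_one, Real.rpow_one]
  ring

/-- The projection of Bh to `E_j` has norm at most d N^(1/(2(j+1))), so the term is O(N^weight). -/
theorem tensorTerm_isLittleO_gauge (hB : IsAdapted B (subE f x p))
    (hκ : ∀ i j, i ∈ block (subE f x p) j ↔ κ i = j) {i : Fin p → ℕ} (hi : 1 < weight i) :
    (fun h => tensorTerm f x i (fun j => (subE f x p j).starProjection (B h)))
      =o[𝓝 0] gauge κ := by
  have hw : (1 : ℝ) < ((weight i : ℚ) : ℝ) := by exact_mod_cast hi
  refine Asymptotics.IsBigO.trans_isLittleO ?_ (gauge_rpow_isLittleO κ hw)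
  refine Asymptotics.IsBigO.of_bound (‖iteratedFDeriv ℝ (∑ j, i j) f x‖ * ∏ j, (d : ℝ) ^ i j)
    (Eventually.of_forall fun h => ?_)
  have hN := gauge_nonneg κ h
  rw [Real.norm_eq_abs, Real.norm_of_nonneg (Real.rpow_nonneg hN _),
    ← prod_rpow_eq_rpow_weight hN, mul_assoc, ← Finset.prod_mul_distrib]
  refine (abs_tensorTerm_le _ _).trans ?_
  refine mul_le_mul_of_nonneg_left ?_ (norm_nonneg _)
  refine Finset.prod_le_prod (fun j _ => by positivity) fun j _ => ?_
  rw [← mul_pow]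
  refine pow_le_pow_left₀ (norm_nonneg _) ?_ _
  refine (norm_starProjection_adapted_le hB hκ h j).trans ?_
  refine (Finset.sum_le_sum fun l _ => ?_ :
    _ ≤ ∑ _l : Fin d, gauge κ h ^ (1 / (2 * (((j : ℕ) : ℝ) + 1)))).trans_eq (by simp)
  split_ifs with hl
  · rw [← hl]; exact abs_apply_le_gauge_rpow κ h l
  · exact Real.rpow_nonneg hN _

/-- The quasi-homogeneous expansion of `f` at a strict polynomial minimum. -/
theorem sub_limitG_isLittleO_gauge (hmin : IsStrictPolynomialMin f x p)
    (hf0 : f x = 0) (heven : 5 ≤ p → EvenTermsVanish f x p) (hB : IsAdapted B (subE f x p))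
    (hκ : ∀ i j, i ∈ block (subE f x p) j ↔ κ i = j) :
    (fun h => f (x + B h) - limitG f x p B h) =o[𝓝 0] gauge κ := by
  have hp : 1 ≤ p := hmin.isLeast.1.1
  have hBlim : Tendsto B (𝓝 0) (𝓝 0) := by simpa using B.continuous.tendsto 0
  have h1 : (fun h => f (x + B h) - taylorPoly f x (2 * p) (B h)) =o[𝓝 0] gauge κ := by
    refine ((taylorPoly_isLittleO (by omega) hmin.contDiff x).comp_tendsto hBlim).trans_isBigO ?_
    simpa [Function.comp_def] using norm_pow_isBigO_gauge κ hp
  -- Outside weight 1, terms of lower weight vanish and terms of higher weight are negligible.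
  have h2 : (fun h => ∑ i ∈ (multiIndices p (2 * p)).filter (fun i => ¬ weight i = 1),
      taylorCoeff i * tensorTerm f x i (fun j => (subE f x p j).starProjection (B h)))
      =o[𝓝 0] gauge κ := by
    refine Asymptotics.IsLittleO.fun_sum fun i hi => ?_
    refine Asymptotics.IsLittleO.const_mul_left ?_ _
    rcases lt_or_gt_of_ne (Finset.mem_filter.1 hi).2 with hw | hw
    · simp only [tensorTerm_starProjection_eq_zero hmin hf0 heven _ hw]
      exact Asymptotics.isLittleO_zero _ _
    · exact tensorTerm_isLittleO_gauge hB hκ hw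
  refine (h1.add h2).congr_left fun h => ?_
  have h3 := taylorPoly_sum_eq (x := x) hmin.contDiff
    (fun j => (subE f x p j).starProjection (B h))
  rw [sum_starProjection_adapted hB hκ h,
    ← Finset.sum_filter_add_sum_filter_not _ (fun i => weight i = 1)] at h3
  rw [limitG_eq, h3]
  ring

theorem tendsto_hadamard_powVec_zero (hκ : ∀ i j, i ∈ block (subE f x p) j ↔ κ i = j)
    (h : Space d) :
    Tendsto (fun t => hadamard (powVec t (exponent (subE f x p))) h) (𝓝[>] 0) (𝓝 0) := by
  have : Tendsto (fun t => WithLp.toLp 2 fun i => t ^ exponent (subE f x p) i * h i) (𝓝[>] 0)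
      (𝓝 (WithLp.toLp 2 fun _ : Fin d => (0 : ℝ))) := by
    refine ((PiLp.continuous_toLp 2 _).tendsto _).comp (tendsto_pi_nhds.2 fun i => ?_)
    have hpos : 0 < exponent (subE f x p) i := by rw [exponent_eq hκ]; positivity
    simpa using (tendsto_rpow_zero_nhdsGT hpos).mul_const (h i)
  exact this

/-- Along the curve the gauge equals t N(h), so o(N) becomes o(t), while g is multiplied by exactly
t. -/
theorem tendsto_rescaled (hmin : IsStrictPolynomialMin f x p)
    (hf0 : f x = 0) (heven : 5 ≤ p → EvenTermsVanish f x p) (hB : IsAdapted B (subE f x p))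
    (hκ : ∀ i j, i ∈ block (subE f x p) j ↔ κ i = j) (h : Space d) :
    Tendsto (fun t : ℝ => (1 / t) *
      f (x + B (hadamard (powVec t (exponent (subE f x p))) h))) (𝓝[>] 0)
      (𝓝 (limitG f x p B h)) := by
  have h1 := (sub_limitG_isLittleO_gauge hmin hf0 heven hB hκ).comp_tendsto
    (tendsto_hadamard_powVec_zero hκ h)
  have h2 : (gauge κ ∘ fun t => hadamard (powVec t (exponent (subE f x p))) h)
      =O[𝓝[>] 0] fun t => t := by
    refine Asymptotics.IsBigO.of_bound (gauge κ h) ?_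
    filter_upwards [self_mem_nhdsWithin] with t ht
    rw [Function.comp_apply, gauge_scale κ (le_of_lt ht) (exponent_eq hκ), norm_mul, mul_comm,
      Real.norm_of_nonneg (gauge_nonneg κ h)]
  have h3 := (h1.trans_isBigO h2).tendsto_div_nhds_zero.add_const (limitG f x p B h)
  rw [zero_add] at h3
  refine h3.congr' ?_
  filter_upwards [self_mem_nhdsWithin] with t ht
  have ht : (0 : ℝ) < t := ht
  rw [Function.comp_apply, limitG_scale hB hκ ht.le]
  field_simp
  ring

theorem limitG_nonneg (hmin : IsStrictPolynomialMin f x p)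
    (hf0 : f x = 0) (heven : 5 ≤ p → EvenTermsVanish f x p) (hB : IsAdapted B (subE f x p))
    (hκ : ∀ i j, i ∈ block (subE f x p) j ↔ κ i = j) (h : Space d) : 0 ≤ limitG f x p B h := by
  refine ge_of_tendsto (tendsto_rescaled hmin hf0 heven hB hκ h) ?_
  have hlim : Tendsto (fun t => x + B (hadamard (powVec t (exponent (subE f x p))) h))
      (𝓝[>] 0) (𝓝 x) := by
    have := ((B.continuous.tendsto 0).comp (tendsto_hadamard_powVec_zero hκ h)).const_add x
    simpa using this
  filter_upwards [hlim.eventually hmin.isLocalMin, self_mem_nhdsWithin] with t h1 ht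
  rw [hf0] at h1
  exact mul_nonneg (one_div_nonneg.2 (le_of_lt ht)) h1

end LimitG

/-! ### Dependence of g on each variable -/

section Nonconstant

variable {d p : ℕ} {f : Space d → ℝ} {x : Space d} {B : Space d ≃ₗᵢ[ℝ] Space d}
  {κ : Fin d → Fin p}

/-- On the `k`-th block, the limit `g` is the form `∇^{2k}f(x)`. -/
theorem limitG_of_mem_subE (hf : ContDiff ℝ ((2 * p : ℕ) : WithTop ℕ∞) f) {k : Fin p}
    {h : Space d} (hk : B h ∈ subE f x p k) :
    limitG f x p B h = (1 / ((2 * (k : ℕ) + 2).factorial : ℝ)) *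
      iteratedFDeriv ℝ (2 * (k : ℕ) + 2) f x (fun _ => B h) := by
  set v : Fin p → Space d := fun j => (subE f x p j).starProjection (B h) with hv
  have hvk : v k = B h := Submodule.starProjection_eq_self_iff.2 hk
  have hv0 : ∀ j, j ≠ k → v j = 0 := fun j hj =>
    (Submodule.starProjection_apply_eq_zero_iff _).2 (subE_le_orthogonal_of_ne hj hk)
  have hsum : ∑ j, v j = B h := by
    rw [Finset.sum_eq_single k (fun j _ hj => hv0 j hj) (by simp), hvk]
  -- Only multi-indices supported on `k` survive, so weight 1 means total degree 2(k + 1).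
  have hw : ∀ i : Fin p → ℕ, tensorTerm f x i v ≠ 0 →
      weight i = ((∑ j, i j : ℕ) : ℚ) / (2 * (((k : ℕ) : ℚ) + 1)) := by
    intro i hi
    have hi0 : ∀ j, j ≠ k → i j = 0 := by
      intro j hj
      by_contra h0
      exact hi (tensorTerm_eq_zero_of_eq_zero i v j h0 (hv0 j hj))
    rw [weight, Finset.sum_eq_single k (fun j _ hj => by simp [hi0 j hj]) (by simp),
      Finset.sum_eq_single k (fun j _ hj => hi0 j hj) (by simp)]
  have hpos : (0 : ℚ) < 2 * (((k : ℕ) : ℚ) + 1) := by positivity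
  rw [limitG, Finset.sum_eq_single (2 * (k : ℕ) + 2)]
  · congr 1
    have h1 := iteratedFDeriv_sum_eq (x := x)
      (hf.of_le (by exact_mod_cast (show 2 * (k : ℕ) + 2 ≤ 2 * p by omega))) v
    rw [hsum] at h1
    rw [h1, Finset.sum_filter_of_ne]
    intro i hi hne
    rw [hw i (right_ne_zero_of_mul hne), (Finset.mem_piAntidiag.1 hi).1]
    push_cast
    rw [div_eq_one_iff_eq hpos.ne']
    ring
  · intro n _ hn
    rw [Finset.sum_eq_zero, mul_zero]
    intro i hi
    obtain ⟨hi1, hi2⟩ := Finset.mem_filter.1 hi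
    by_contra hne
    rw [hw i (right_ne_zero_of_mul hne), (Finset.mem_piAntidiag.1 hi1).1,
      div_eq_one_iff_eq hpos.ne'] at hi2
    exact hn (by exact_mod_cast hi2.trans (by ring : _ = 2 * ((k : ℕ) : ℚ) + 2))
  · intro hn
    exact absurd (Finset.mem_Icc.2 ⟨by omega, by omega⟩) hn

/-- By symmetry, the derivative at s = 0 of the diagonal value at a + s v is n + 1 times the value
with one slot v. -/
theorem iteratedFDeriv_cons_eq_zero_of_line {n : ℕ}
    (hf : ContDiff ℝ ((n + 1 : ℕ) : WithTop ℕ∞) f) {a v : Space d}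
    (h : ∀ s : ℝ, iteratedFDeriv ℝ (n + 1) f x (fun _ => a + s • v)
      = iteratedFDeriv ℝ (n + 1) f x (fun _ => a)) :
    iteratedFDeriv ℝ (n + 1) f x (Fin.cons v (fun _ : Fin n => a)) = 0 := by
  set M := iteratedFDeriv ℝ (n + 1) f x with hM
  have hl : HasDerivAt (fun s : ℝ => (fun _ : Fin (n + 1) => a + s • v)) (fun _ => v) 0 := by
    refine hasDerivAt_pi.2 fun _ => ?_
    simpa using ((hasDerivAt_id (0 : ℝ)).smul_const v).const_add a
  have h1 := (M.hasFDerivAt (x := fun _ : Fin (n + 1) => a + (0 : ℝ) • v)).comp_hasDerivAt 0 hl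
  have h2 : HasDerivAt (fun s : ℝ => M (fun _ => a + s • v)) 0 0 := by
    rw [funext h]
    exact hasDerivAt_const _ _
  have h3 := h1.unique h2
  rw [ContinuousMultilinearMap.linearDeriv_apply] at h3
  have h4 : ∀ l : Fin (n + 1), M (Function.update (fun _ => a + (0 : ℝ) • v) l v)
      = M (Fin.cons v (fun _ : Fin n => a)) := by
    intro l
    rw [hM, ← iteratedFDeriv_comp_perm hf x (Fin.cons v (fun _ : Fin n => a)) (Equiv.swap 0 l)]
    congr 1
    funext j
    simp only [zero_smul, add_zero, Function.comp_apply]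
    by_cases hj : j = l
    · subst hj; simp
    · rw [Function.update_of_ne hj]
      have : Equiv.swap 0 l j ≠ 0 := by
        intro h0
        rw [Equiv.swap_apply_eq_iff, Equiv.swap_apply_left] at h0
        exact hj h0
      obtain ⟨j', hj'⟩ := Fin.exists_succ_eq.2 this
      rw [← hj', Fin.cons_succ]
  rw [Finset.sum_congr rfl fun l _ => h4 l, Finset.sum_const, Finset.card_univ, Fintype.card_fin,
    nsmul_eq_mul] at h3
  exact (mul_eq_zero.1 h3).resolve_left (by positivity)

theorem iteratedFDeriv_cons_add_of_mem {k : ℕ}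
    (hf : ContDiff ℝ ((2 * k + 2 : ℕ) : WithTop ℕ∞) f) {v a u : Space d}
    (hv : v ∈ subF f x k) (ha : a ∈ subF f x k) (hu : u ∈ subF f x (k + 1)) :
    iteratedFDeriv ℝ (2 * k + 2) f x (Fin.cons v (fun _ : Fin (2 * k + 1) => a + u))
      = iteratedFDeriv ℝ (2 * k + 2) f x (Fin.cons v (fun _ : Fin (2 * k + 1) => a)) := by
  -- The 0 in the first slot, which also lies in F_{k+1}, lets all slots be expanded at once: every
  -- term but the first then has an argument in F_{k+1}.
  have hsplit : (Fin.cons v (fun _ : Fin (2 * k + 1) => a + u) : Fin (2 * k + 2) → Space d)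
      = (Fin.cons v (fun _ => a) : Fin (2 * k + 2) → Space d)
        + (Fin.cons 0 (fun _ => u) : Fin (2 * k + 2) → Space d) := by
    funext j
    refine Fin.cases ?_ (fun j => ?_) j <;> simp
  have hm' : ∀ l, (Fin.cons 0 (fun _ => u) : Fin (2 * k + 2) → Space d) l ∈ subF f x (k + 1) :=
    fun l => by
      refine Fin.cases ?_ (fun j => ?_) l
      · simp
      · simpa using hu
  have hm : ∀ l, (Fin.cons v (fun _ => a) : Fin (2 * k + 2) → Space d) l ∈ subF f x k :=
    fun l => by
      refine Fin.cases ?_ (fun j => ?_) l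
      · simpa using hv
      · simpa using ha
  rw [hsplit, ContinuousMultilinearMap.map_add_univ, Finset.sum_eq_single Finset.univ]
  · simp
  · intro s _ hs
    obtain ⟨l, hl⟩ : ∃ l, l ∉ s := by
      by_contra! h
      exact hs (Finset.eq_univ_iff_forall.2 h)
    refine iteratedFDeriv_eq_zero_of_mem_subF hf _ (fun j => ?_) l ?_
    · by_cases hj : j ∈ s
      · rw [Finset.piecewise_eq_of_mem _ _ _ hj]; exact hm j
      · rw [Finset.piecewise_eq_of_notMem _ _ _ hj]; exact subF_succ_le k (hm' j)
    · rw [Finset.piecewise_eq_of_notMem _ _ _ hl]; exact hm' l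
  · simp

/-- Membership is tested against y ∈ F_k. The F_{k+1} component of y does not matter, so y may be
taken orthogonal to F_{k+1}, where the constancy along v can be differentiated. -/
theorem mem_subF_succ_of_constant {k : ℕ}
    (hf : ContDiff ℝ ((2 * k + 2 : ℕ) : WithTop ℕ∞) f) {v : Space d} (hv : v ∈ subF f x k)
    (h : ∀ a ∈ subF f x k ⊓ (subF f x (k + 1))ᗮ, ∀ s : ℝ,
      iteratedFDeriv ℝ (2 * k + 2) f x (fun _ => a + s • v)
        = iteratedFDeriv ℝ (2 * k + 2) f x (fun _ => a)) :
    v ∈ subF f x (k + 1) := by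
  refine mem_subF_succ_iff.2 ⟨hv, fun y hy => ?_⟩
  set u := (subF f x (k + 1)).starProjection y
  have hu : u ∈ subF f x (k + 1) := Submodule.starProjection_apply_mem _ _
  have hao : y - u ∈ (subF f x (k + 1))ᗮ := Submodule.sub_starProjection_mem_orthogonal y
  have ha : y - u ∈ subF f x k := Submodule.sub_mem _ hy (subF_succ_le k hu)
  have := iteratedFDeriv_cons_add_of_mem hf hv ha hu
  rw [sub_add_cancel] at this
  rw [this]
  exact iteratedFDeriv_cons_eq_zero_of_line (n := 2 * k + 1) hf (h _ ⟨ha, hao⟩)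

/-- A power of the single last letter has weight n / (2p), below 1. -/
theorem iteratedFDeriv_eq_zero_of_last (hmin : IsStrictPolynomialMin f x p)
    (hf0 : f x = 0) (heven : 5 ≤ p → EvenTermsVanish f x p) {k : Fin p} (hk : (k : ℕ) + 1 = p)
    {v : Space d} (hv : v ∈ subE f x p k) {n : ℕ} (hn : n < 2 * p) :
    iteratedFDeriv ℝ n f x (fun _ => v) = 0 := by
  have hfn : ContDiff ℝ (n : WithTop ℕ∞) f := hmin.contDiff.of_le (by exact_mod_cast hn.le)
  have hvk : (subE f x p k).starProjection v = v := Submodule.starProjection_eq_self_iff.2 hv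
  have h1 := iteratedFDeriv_word (x := x) hfn (fun _ : Fin n => k)
    (fun j => (subE f x p j).starProjection v)
  simp only [hvk] at h1
  rw [h1]
  refine tensorTerm_starProjection_eq_zero hmin hf0 heven v ?_
  have hc : letterCount (fun _ : Fin n => k) = fun j => if j = k then n else 0 := by
    funext j
    by_cases hj : j = k
    · simp [letterCount, hj]
    · simp [letterCount, hj, Ne.symm hj]
  rw [hc, weight, Finset.sum_eq_single k (fun j _ hj => by simp [hj]) (by simp), if_pos rfl,
    div_lt_one (by positivity)]
  have : (n : ℚ) < 2 * p := by exact_mod_cast hn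
  have hk' : ((k : ℕ) : ℚ) + 1 = p := by exact_mod_cast hk
  rwa [hk']

/-- Otherwise all derivatives of order 2 to 2p would vanish along v, against the positivity of the
Taylor polynomial near 0. -/
theorem iteratedFDeriv_last_ne_zero (hmin : IsStrictPolynomialMin f x p)
    (hf0 : f x = 0) (heven : 5 ≤ p → EvenTermsVanish f x p) {k : Fin p} (hk : (k : ℕ) + 1 = p)
    {v : Space d} (hv : v ∈ subE f x p k) (hv0 : v ≠ 0) :
    iteratedFDeriv ℝ (2 * p) f x (fun _ => v) ≠ 0 := by
  intro hzero
  obtain ⟨hp, r, hr, hpos⟩ := hmin.isLeast.1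
  have hvn : 0 < ‖v‖ := norm_pos_iff.2 hv0
  set s : ℝ := r / (2 * ‖v‖) with hs
  have hs0 : 0 < s := by positivity
  have hmem : s • v ∈ Metric.ball (0 : Space d) r := by
    rw [mem_ball_zero_iff, norm_smul, Real.norm_of_nonneg hs0.le, hs]
    field_simp
    linarith
  refine (hpos (s • v) hmem (smul_ne_zero hs0.ne' hv0)).ne' ?_
  refine Finset.sum_eq_zero fun n hn => ?_
  have := (iteratedFDeriv ℝ n f x).map_smul_univ (fun _ => s) (fun _ => v)
  rw [this]
  rcases (Finset.mem_Icc.1 hn).2.eq_or_lt with h | h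
  · subst h; rw [hzero]; simp
  · rw [iteratedFDeriv_eq_zero_of_last hmin hf0 heven hk hv h]; simp

theorem limitG_nonconstant (hmin : IsStrictPolynomialMin f x p)
    (hf0 : f x = 0) (heven : 5 ≤ p → EvenTermsVanish f x p) (hB : IsAdapted B (subE f x p))
    (hκ : ∀ i j, i ∈ block (subE f x p) j ↔ κ i = j) :
    NonconstantInEachVariable (limitG f x p B) := by
  intro j
  set v := B (EuclideanSpace.single j 1) with hv
  have hv0 : v ≠ 0 := by
    rw [hv, Ne, LinearIsometryEquiv.map_eq_zero_iff]
    intro h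
    simpa using congrArg (fun w : Space d => w j) h
  set k := κ j with hk
  have hvk : v ∈ subE f x p k := hB k j ((hκ j k).2 hk.symm)
  rcases Nat.lt_or_ge ((k : ℕ) + 1) p with hkp | hkp
  -- Not the last block: constancy of g makes ∇^{2(k+1)} f(x) constant along v on `E_k`, which puts
  -- v in F_{k+1}, orthogonal to `E_k`.
  · by_contra hcon
    have hE : subE f x p k = subF f x k ⊓ (subF f x (k + 1))ᗮ := by rw [subE, if_pos hkp]
    have hfk : ContDiff ℝ ((2 * (k : ℕ) + 2 : ℕ) : WithTop ℕ∞) f :=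
      hmin.contDiff.of_le (by exact_mod_cast (show 2 * (k : ℕ) + 2 ≤ 2 * p by omega))
    have hmem : v ∈ subF f x (k + 1) := by
      refine mem_subF_succ_of_constant hfk (subE_le_subF k hvk) fun a ha s => ?_
      rw [← hE] at ha
      have h1 : B (B.symm a) = a := B.apply_symm_apply a
      have h2 : B (B.symm a + s • EuclideanSpace.single j 1) = a + s • v := by
        rw [map_add, map_smul, h1]
      have h3 : limitG f x p B (B.symm a + s • EuclideanSpace.single j 1)
          = limitG f x p B (B.symm a) := by
        by_contra hne
        refine hcon ⟨_, _, fun l hl => ?_, hne⟩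
        simp [hl]
      rw [limitG_of_mem_subE hmin.contDiff (k := k)
          (by rw [h2]; exact Submodule.add_mem _ ha (Submodule.smul_mem _ _ hvk)),
        limitG_of_mem_subE hmin.contDiff (k := k) (by rw [h1]; exact ha), h1, h2] at h3
      exact mul_left_cancel₀ (by positivity) h3
    have hvo : v ∈ (subF f x (k + 1))ᗮ := (hE ▸ hvk : v ∈ subF f x k ⊓ (subF f x (k + 1))ᗮ).2
    exact hv0 (inner_self_eq_zero.1 (hvo v hmem))
  · have hkp' : (k : ℕ) + 1 = p := le_antisymm k.2 hkp
    refine ⟨EuclideanSpace.single j 1, 0, fun l hl => by simp [hl], ?_⟩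
    rw [limitG_zero, limitG_of_mem_subE hmin.contDiff (k := k) hvk]
    have h2 : 2 * (k : ℕ) + 2 = 2 * p := by omega
    rw [h2]
    exact mul_ne_zero (by positivity) (iteratedFDeriv_last_ne_zero hmin hf0 heven hkp' hvk hv0)

end Nonconstant

/-! ### Lower bounds by the gauge -/

section LowerBound

variable {d p : ℕ} (κ : Fin d → Fin p)

theorem tendsto_hadamard_powVec_cobounded {α : Fin d → ℝ} (hα : ∀ i, 0 < α i) {h : Space d}
    (hh : h ≠ 0) :
    Tendsto (fun t => hadamard (powVec t α) h) atTop (Bornology.cobounded (Space d)) := by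
  rw [← tendsto_norm_atTop_iff_cobounded]
  obtain ⟨i, hi⟩ : ∃ i, h i ≠ 0 := by
    by_contra! h0
    exact hh (PiLp.ext h0)
  have h1 : Tendsto (fun t : ℝ => t ^ α i * |h i|) atTop atTop :=
    (tendsto_rpow_atTop (hα i)).atTop_mul_const (abs_pos.2 hi)
  refine tendsto_atTop_mono' _ ?_ h1
  filter_upwards [eventually_ge_atTop (0 : ℝ)] with t ht
  have := PiLp.norm_apply_le (hadamard (powVec t α) h) i
  rwa [hadamard_powVec_apply, norm_mul, Real.norm_of_nonneg (Real.rpow_nonneg ht _),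
    Real.norm_eq_abs] at this

/-- A coercive quasi-homogeneous function dominates the gauge. -/
theorem exists_mul_gauge_le {g : Space d → ℝ} {α : Fin d → ℝ}
    (hα : ∀ i, α i = 1 / (2 * ((κ i : ℝ) + 1))) (hcont : Continuous g) (hnonneg : ∀ h, 0 ≤ g h)
    (hscale : ∀ t : ℝ, 0 ≤ t → ∀ h, g (hadamard (powVec t α) h) = t * g h)
    (hco : Coercive g) : ∃ c > 0, ∀ h, c * gauge κ h ≤ g h := by
  have hα0 : ∀ i, 0 < α i := fun i => by rw [hα]; positivity
  -- A nonzero zero of g would give an orbit of zeros tending to infinity, against coercivity.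
  have hpos : ∀ h, h ≠ 0 → 0 < g h := by
    intro h hh
    refine (hnonneg h).lt_of_ne' fun h0 => ?_
    have h1 := hco.comp (tendsto_hadamard_powVec_cobounded hα0 hh)
    obtain ⟨t, ht, ht0⟩ := ((h1.eventually_gt_atTop 0).and (eventually_ge_atTop 0)).exists
    rw [Function.comp_apply, hscale t ht0, h0, mul_zero] at ht
    exact lt_irrefl _ ht
  have hK : IsCompact {h : Space d | gauge κ h = 1} := by
    refine Metric.isCompact_of_isClosed_isBounded
      (isClosed_eq (continuous_gauge κ) continuous_const) ?_
    refine (Metric.isBounded_closedBall (x := (0 : Space d)) (r := 1 + d)).subset fun h hh => ?_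
    have h1 := norm_sq_sub_le_gauge κ h
    rw [show gauge κ h = 1 from hh] at h1
    rw [mem_closedBall_zero_iff]
    have hd : (0 : ℝ) ≤ d := by positivity
    nlinarith [norm_nonneg h]
  obtain ⟨c, hc, hcK⟩ : ∃ c > 0, ∀ h, gauge κ h = 1 → c ≤ g h := by
    -- The level set is empty when d = 0.
    rcases Set.eq_empty_or_nonempty {h : Space d | gauge κ h = 1} with he | hne
    · refine ⟨1, one_pos, fun h hh => ?_⟩
      exact absurd (show h ∈ {h : Space d | gauge κ h = 1} from hh) (by simp [he])
    · obtain ⟨h0, hh0, hmin⟩ := hK.exists_isMinOn hne hcont.continuousOn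
      refine ⟨g h0, hpos h0 ?_, fun h hh => hmin hh⟩
      rintro rfl
      exact zero_ne_one ((gauge_zero κ).symm.trans hh0)
  refine ⟨c, hc, fun h => ?_⟩
  by_cases hh : h = 0
  · rw [hh, gauge_zero, mul_zero]; exact hnonneg 0
  · have hN := gauge_pos κ hh
    have h1 := hcK (hadamard (powVec (gauge κ h)⁻¹ α) h)
      (by rw [gauge_scale κ (inv_nonneg.2 hN.le) hα, inv_mul_cancel₀ hN.ne'])
    rw [hscale _ (inv_nonneg.2 hN.le), inv_mul_eq_div, le_div_iff₀ hN] at h1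
    exact h1

theorem integrable_exp_neg_gauge {c : ℝ} (hc : 0 < c) :
    Integrable (fun h : Space d => Real.exp (-(c * gauge κ h))) volume := by
  have h1 := (GaussianFourier.integrable_cexp_neg_mul_sq_norm_add (V := Space d)
    (b := (c : ℂ)) (by simpa using hc) 0 0).norm.const_mul (Real.exp (c * d))
  refine h1.mono' (by have := continuous_gauge κ; fun_prop)
    (Eventually.of_forall fun h => ?_)
  rw [Real.norm_of_nonneg (Real.exp_pos _).le, Complex.norm_exp, ← Real.exp_add]
  refine Real.exp_le_exp.2 ?_
  have h2 := mul_le_mul_of_nonneg_left (norm_sq_sub_le_gauge κ h) hc.le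
  have h3 : (-(c : ℂ) * (‖h‖ : ℂ) ^ 2 + 0 * (inner ℝ (0 : Space d) h : ℂ)).re = -c * ‖h‖ ^ 2 := by
    rw [zero_mul, add_zero]
    norm_cast
  rw [h3]
  linarith

/-- A function which is equivalent to a dominating `g` and positive away from the origin dominates
the gauge on every ball. -/
theorem exists_mul_gauge_le_on_closedBall {F g : Space d → ℝ} (hF : Continuous F)
    (hFg : (fun h => F h - g h) =o[𝓝 0] gauge κ) {c : ℝ} (hc : 0 < c)
    (hg : ∀ h, c * gauge κ h ≤ g h) {δ : ℝ}
    (hpos : ∀ h, ‖h‖ ≤ δ → h ≠ 0 → 0 < F h) :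
    ∃ c' > 0, ∀ h, ‖h‖ ≤ δ → c' * gauge κ h ≤ F h := by
  -- Near 0, half of `c` absorbs the remainder; on the remaining compact annulus the ratio of F to
  -- the gauge has a positive minimum.
  obtain ⟨ε, hε, hball⟩ := Metric.eventually_nhds_iff_ball.1 (hFg.bound (half_pos hc))
  have hnear : ∀ h, ‖h‖ < ε → c / 2 * gauge κ h ≤ F h := by
    intro h hh
    have h1 := hball h (by simpa using hh)
    rw [Real.norm_eq_abs, Real.norm_of_nonneg (gauge_nonneg κ h)] at h1
    have h2 := (abs_le.1 h1).1
    have h3 := hg h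
    linarith
  set A := {h : Space d | ε ≤ ‖h‖ ∧ ‖h‖ ≤ δ}
  have hA : IsCompact A := by
    refine Metric.isCompact_of_isClosed_isBounded
      ((isClosed_le continuous_const continuous_norm).inter
        (isClosed_le continuous_norm continuous_const)) ?_
    exact (Metric.isBounded_closedBall (x := (0 : Space d)) (r := δ)).subset
      fun h hh => mem_closedBall_zero_iff.2 hh.2
  obtain ⟨η, hη, hηA⟩ : ∃ η > 0, ∀ h ∈ A, η * gauge κ h ≤ F h := by
    rcases A.eq_empty_or_nonempty with he | hne
    · exact ⟨1, one_pos, by simp [he]⟩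
    · have hne0 : ∀ h ∈ A, h ≠ 0 := by
        rintro h hh rfl
        have := hh.1
        rw [norm_zero] at this
        linarith
      have hcont : ContinuousOn (fun h => F h / gauge κ h) A :=
        hF.continuousOn.div (continuous_gauge κ).continuousOn
          fun h hh => (gauge_pos κ (hne0 h hh)).ne'
      obtain ⟨h0, hh0, hmin⟩ := hA.exists_isMinOn hne hcont
      refine ⟨F h0 / gauge κ h0,
        div_pos (hpos h0 hh0.2 (hne0 h0 hh0)) (gauge_pos κ (hne0 h0 hh0)), fun h hh => ?_⟩
      exact (le_div_iff₀ (gauge_pos κ (hne0 h hh))).1 (hmin hh)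
  refine ⟨min (c / 2) η, lt_min (half_pos hc) hη, fun h hh => ?_⟩
  rcases lt_or_ge ‖h‖ ε with h1 | h1
  · exact (mul_le_mul_of_nonneg_right (min_le_left _ _) (gauge_nonneg κ h)).trans (hnear h h1)
  · exact (mul_le_mul_of_nonneg_right (min_le_right _ _) (gauge_nonneg κ h)).trans
      (hηA h ⟨h1, hh⟩)

end LowerBound

/-! ### The anisotropic change of variables -/

section ChangeOfVariables

variable {d : ℕ}

/-- Element-wise multiplication by a fixed vector. -/
noncomputable def hadamardLinear (a : Space d) : Space d →ₗ[ℝ] Space d where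
  toFun := hadamard a
  map_add' u v := by ext i; simp [hadamard, mul_add]
  map_smul' c u := by ext i; simp [hadamard, mul_left_comm]

theorem det_hadamardLinear (a : Space d) : LinearMap.det (hadamardLinear a) = ∏ i, a i := by
  have h1 : hadamardLinear a = (WithLp.linearEquiv 2 ℝ (Fin d → ℝ)).symm.toLinearMap ∘ₗ
      Matrix.toLin' (Matrix.diagonal fun i => a i) ∘ₗ
      (WithLp.linearEquiv 2 ℝ (Fin d → ℝ)).symm.symm.toLinearMap := by
    ext u i
    simp [hadamardLinear, hadamard, Matrix.mulVec_diagonal]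
  rw [h1, LinearMap.det_conj, LinearMap.det_toLin', Matrix.det_diagonal]

theorem measurable_hadamard (a : Space d) : Measurable (hadamard a) :=
  (hadamardLinear a).continuous_of_finiteDimensional.measurable

/-- The scaling has Jacobian t^(∑ α); the isometry and the translation preserve volume. -/
theorem integral_comp_affine (x : Space d) (B : Space d ≃ₗᵢ[ℝ] Space d) {t : ℝ} (ht : 0 < t)
    (α : Fin d → ℝ) {F : Space d → ℝ} (hF : Measurable F) :
    ∫ h, F (x + B (hadamard (powVec t α) h)) = t ^ (-∑ i, α i) * ∫ y, F y := by
  have hdet : LinearMap.det (hadamardLinear (powVec t α)) = t ^ (∑ i, α i) := by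
    rw [det_hadamardLinear, Real.rpow_sum_of_pos ht]
    rfl
  have hpos : 0 < t ^ (∑ i, α i) := Real.rpow_pos_of_pos ht _
  have hdet0 : LinearMap.det (hadamardLinear (powVec t α)) ≠ 0 := by rw [hdet]; exact hpos.ne'
  have hmap := Measure.map_linearMap_addHaar_eq_smul_addHaar (volume : Measure (Space d)) hdet0
  have hG : Measurable fun z => F (x + B z) :=
    hF.comp (measurable_const.add B.continuous.measurable)
  have h1 : ∫ h, F (x + B (hadamard (powVec t α) h))
      = ∫ z, F (x + B z) ∂(Measure.map (hadamardLinear (powVec t α)) volume) :=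
    (integral_map (measurable_hadamard _).aemeasurable hG.aestronglyMeasurable).symm
  have h2 : ∫ z, F (x + B z) = ∫ y, F y := by
    rw [B.measurePreserving.integral_comp B.toHomeomorph.measurableEmbedding
      (fun z => F (x + z)), integral_add_left_eq_self]
  rw [h1, hmap, integral_smul_measure, h2, hdet, Real.rpow_neg ht.le,
    abs_of_pos (inv_pos.2 hpos), ENNReal.toReal_ofReal (inv_pos.2 hpos).le, smul_eq_mul]

end ChangeOfVariables

/-! ### Local Laplace asymptotics -/

section Laplace

variable {d p : ℕ} (κ : Fin d → Fin p)

/-- Laplace's method around one minimum. -/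
theorem tendsto_local_laplace {f g : Space d → ℝ} {x : Space d}
    {B : Space d ≃ₗᵢ[ℝ] Space d} {α : Fin d → ℝ} (hα : ∀ i, α i = 1 / (2 * ((κ i : ℝ) + 1)))
    (hf : Continuous f)
    (hlim : ∀ h, Tendsto (fun t : ℝ => (1 / t) * f (x + B (hadamard (powVec t α) h)))
      (𝓝[>] 0) (𝓝 (g h)))
    (hzero : ∀ h, Tendsto (fun t => hadamard (powVec t α) h) (𝓝[>] 0) (𝓝 0))
    {δ c : ℝ} (hδ : 0 < δ) (hc : 0 < c) (hlow : ∀ h, ‖h‖ ≤ δ → c * gauge κ h ≤ f (x + B h))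
    {Φ : ℝ → Space d → ℝ} {ψ : Space d → ℝ} {C : ℝ} (hΦm : ∀ t, Measurable (Φ t))
    (hΦb : ∀ t y, |Φ t y| ≤ C)
    (hΦ : ∀ h, Tendsto (fun t => Φ t (x + B (hadamard (powVec t α) h))) (𝓝[>] 0) (𝓝 (ψ h))) :
    Tendsto (fun t : ℝ => t ^ (-∑ i, α i) *
      ∫ y in Metric.ball x δ, Real.exp (-f y / t) * Φ t y) (𝓝[>] 0)
      (𝓝 (∫ h, Real.exp (-g h) * ψ h)) := by
  -- `Φ` depends on t so that the same asymptotics serve a fixed test function and one read in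
  -- rescaled coordinates.
  set F : ℝ → Space d → ℝ := fun t =>
    (Metric.ball x δ).indicator fun y => Real.exp (-f y / t) * Φ t y with hFdef
  have hFm : ∀ t, Measurable (F t) := fun t =>
    (((hf.measurable.neg.div_const t).exp).mul (hΦm t)).indicator measurableSet_ball
  have hmem : ∀ z : Space d, x + B z ∈ Metric.ball x δ ↔ ‖z‖ < δ := by
    intro z
    rw [Metric.mem_ball, dist_eq_norm, add_sub_cancel_left, LinearIsometryEquiv.norm_map]
  have hmain : Tendsto (fun t => ∫ h, F t (x + B (hadamard (powVec t α) h))) (𝓝[>] 0)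
      (𝓝 (∫ h, Real.exp (-g h) * ψ h)) := by
    refine tendsto_integral_filter_of_dominated_convergence
      (fun h => C * Real.exp (-(c * gauge κ h))) ?_ ?_
      ((integrable_exp_neg_gauge κ hc).const_mul C) ?_
    · refine Eventually.of_forall fun t => Measurable.aestronglyMeasurable ?_
      exact (hFm t).comp (measurable_const.add
        (B.continuous.measurable.comp (measurable_hadamard _)))
    · filter_upwards [self_mem_nhdsWithin] with t ht
      have ht : (0 : ℝ) < t := ht
      refine Eventually.of_forall fun h => ?_
      have hC : 0 ≤ C := (abs_nonneg _).trans (hΦb 0 0)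
      by_cases hh : x + B (hadamard (powVec t α) h) ∈ Metric.ball x δ
      · rw [hFdef]
        simp only [Set.indicator_of_mem hh]
        rw [norm_mul, Real.norm_of_nonneg (Real.exp_pos _).le, mul_comm, Real.norm_eq_abs]
        refine mul_le_mul (hΦb _ _) (Real.exp_le_exp.2 ?_) (Real.exp_pos _).le hC
        -- The lower bound at the scaled point is c t N(h); division by t leaves a bound independent
        -- of t.
        have h1 := hlow _ ((hmem _).1 hh).le
        rw [gauge_scale κ ht.le hα] at h1
        rw [div_le_iff₀ ht]
        linarith
      · rw [hFdef]
        simp only [Set.indicator_of_notMem hh, norm_zero]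
        positivity
    · refine Eventually.of_forall fun h => ?_
      have h1 : Tendsto (fun t => Real.exp (-((1 / t) * f (x + B (hadamard (powVec t α) h))))
          * Φ t (x + B (hadamard (powVec t α) h))) (𝓝[>] 0) (𝓝 (Real.exp (-g h) * ψ h)) :=
        ((Real.continuous_exp.tendsto _).comp (hlim h).neg).mul (hΦ h)
      refine h1.congr' ?_
      filter_upwards [(hzero h).eventually (Metric.ball_mem_nhds 0 hδ)] with t ht
      have hh : x + B (hadamard (powVec t α) h) ∈ Metric.ball x δ :=
        (hmem _).2 (by simpa using ht)
      rw [hFdef]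
      simp only [Set.indicator_of_mem hh]
      congr 2
      ring
  refine hmain.congr' ?_
  filter_upwards [self_mem_nhdsWithin] with t ht
  rw [integral_comp_affine x B ht α (hFm t), integral_indicator measurableSet_ball]

end Laplace

/-! ### Global asymptotics and weak limits -/

section Global

variable {d m : ℕ} {f : Space d → ℝ}

/-- By coercivity the part of {f ≤ 1} outside U is compact, and f has a positive minimum there if it
is nonempty. -/
theorem exists_pos_le_off_open (hf : Continuous f) (hco : Coercive f) {U : Set (Space d)}
    (hU : IsOpen U) (hpos : ∀ y ∉ U, 0 < f y) : ∃ η > 0, ∀ y ∉ U, η ≤ f y := by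
  have hb : Bornology.IsBounded {y | f y ≤ 1} := by
    rw [Bornology.isBounded_def]
    filter_upwards [hco.eventually_gt_atTop 1] with y hy
    simpa using hy
  have hK : IsCompact (Uᶜ ∩ {y | f y ≤ 1}) :=
    Metric.isCompact_of_isClosed_isBounded
      (hU.isClosed_compl.inter (isClosed_le hf continuous_const))
      (hb.subset Set.inter_subset_right)
  rcases Set.eq_empty_or_nonempty (Uᶜ ∩ {y | f y ≤ 1}) with he | hne
  · refine ⟨1, one_pos, fun y hy => ?_⟩
    by_contra! hlt
    exact (Set.eq_empty_iff_forall_notMem.1 he y) ⟨hy, hlt.le⟩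
  · obtain ⟨y0, hy0, hmin⟩ := hK.exists_isMinOn hne hf.continuousOn
    refine ⟨min 1 (f y0), lt_min one_pos (hpos y0 hy0.1), fun y hy => ?_⟩
    rcases le_total (f y) 1 with h1 | h1
    · exact (min_le_right _ _).trans (hmin ⟨hy, h1⟩)
    · exact (min_le_left _ _).trans h1

/-- Equivalent to (a - η)(1/t - 1) ≥ 0. For η > 0 it splits off a factor exponentially small in 1/t
from e^(-f); for η = 0 it gives integrability of e^(-f/t). -/
theorem exp_neg_div_le {a η t : ℝ} (hηa : η ≤ a) (ht : 0 < t) (ht1 : t ≤ 1) :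
    Real.exp (-a / t) ≤ Real.exp η * Real.exp (-(η * t⁻¹)) * Real.exp (-a) := by
  rw [← Real.exp_add, ← Real.exp_add]
  refine Real.exp_le_exp.2 ?_
  have h1 : 1 ≤ t⁻¹ := (one_le_inv₀ ht).2 ht1
  rw [div_eq_mul_inv]
  nlinarith

theorem integrable_exp_neg_div (hf : Continuous f) (hnonneg : ∀ y, 0 ≤ f y)
    (hint : Integrable (fun y => Real.exp (-f y)) volume) {t : ℝ} (ht : 0 < t) (ht1 : t ≤ 1) :
    Integrable (fun y => Real.exp (-f y / t)) volume := by
  refine hint.mono' (by fun_prop) (Eventually.of_forall fun y => ?_)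
  rw [Real.norm_of_nonneg (Real.exp_pos _).le]
  simpa using exp_neg_div_le (hnonneg y) ht ht1

theorem integrable_exp_neg_div_mul (hf : Continuous f) (hnonneg : ∀ y, 0 ≤ f y)
    (hint : Integrable (fun y => Real.exp (-f y)) volume) {t : ℝ} (ht : 0 < t) (ht1 : t ≤ 1)
    {φ : Space d → ℝ} {C : ℝ} (hφ : Measurable φ) (hC : ∀ y, |φ y| ≤ C) :
    Integrable (fun y => Real.exp (-f y / t) * φ y) volume :=
  (integrable_exp_neg_div hf hnonneg hint ht ht1).mul_bdd hφ.aestronglyMeasurable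
    (Eventually.of_forall hC)

theorem tendsto_rpow_mul_exp_neg_inv (s : ℝ) {η : ℝ} (hη : 0 < η) :
    Tendsto (fun t : ℝ => t ^ (-s) * Real.exp (-(η * t⁻¹))) (𝓝[>] 0) (𝓝 0) := by
  refine ((tendsto_rpow_mul_exp_neg_mul_atTop_nhds_zero s η hη).comp
    tendsto_inv_nhdsGT_zero).congr' ?_
  filter_upwards [self_mem_nhdsWithin] with t ht
  rw [Function.comp_apply, Real.inv_rpow (le_of_lt ht), ← Real.rpow_neg (le_of_lt ht), neg_mul]

/-- The Gibbs weight away from the minimizers is negligible. -/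
theorem tendsto_laplace_off_open (hf : Continuous f) (hco : Coercive f)
    (hint : Integrable (fun y => Real.exp (-f y)) volume) {U : Set (Space d)} (hU : IsOpen U)
    (hpos : ∀ y ∉ U, 0 < f y) {φ : Space d → ℝ} {C : ℝ} (hC : ∀ y, |φ y| ≤ C) (s : ℝ) :
    Tendsto (fun t : ℝ => t ^ (-s) * ∫ y in Uᶜ, Real.exp (-f y / t) * φ y) (𝓝[>] 0) (𝓝 0) := by
  obtain ⟨η, hη, hηU⟩ := exists_pos_le_off_open hf hco hU hpos
  have hC0 : 0 ≤ C := (abs_nonneg _).trans (hC 0)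
  have h1 := (tendsto_rpow_mul_exp_neg_inv s hη).const_mul
    (Real.exp η * C * ∫ y in Uᶜ, Real.exp (-f y))
  rw [mul_zero] at h1
  refine squeeze_zero_norm' ?_ h1
  filter_upwards [Ioo_mem_nhdsGT (zero_lt_one' ℝ)] with t ht
  rw [norm_mul, Real.norm_of_nonneg (Real.rpow_nonneg ht.1.le _)]
  have h2 : ‖∫ y in Uᶜ, Real.exp (-f y / t) * φ y‖
      ≤ ∫ y in Uᶜ, (Real.exp η * Real.exp (-(η * t⁻¹)) * C) * Real.exp (-f y) := by
    refine norm_integral_le_of_norm_le (hint.integrableOn.const_mul _) ?_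
    filter_upwards [ae_restrict_mem hU.measurableSet.compl] with y hy
    rw [norm_mul, Real.norm_of_nonneg (Real.exp_pos _).le, Real.norm_eq_abs]
    calc Real.exp (-f y / t) * |φ y|
        ≤ (Real.exp η * Real.exp (-(η * t⁻¹)) * Real.exp (-f y)) * C :=
          mul_le_mul (exp_neg_div_le (hηU y hy) ht.1 ht.2.le) (hC y) (abs_nonneg _) (by positivity)
      _ = _ := by ring
  rw [integral_const_mul] at h2
  calc _ ≤ t ^ (-s) * ((Real.exp η * Real.exp (-(η * t⁻¹)) * C) * ∫ y in Uᶜ, Real.exp (-f y)) :=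
        mul_le_mul_of_nonneg_left h2 (Real.rpow_nonneg ht.1.le _)
    _ = _ := by ring

/-- Laplace's method: the contributions of the minima of largest order of magnitude add up. -/
theorem tendsto_global_laplace (hf : Continuous f) (hco : Coercive f) (hnonneg : ∀ y, 0 ≤ f y)
    (hint : Integrable (fun y => Real.exp (-f y)) volume) {x : Fin m → Space d} {δ : ℝ}
    (hdisj : Pairwise (fun i k => Disjoint (Metric.ball (x i) δ) (Metric.ball (x k) δ)))
    (hpos : ∀ y ∉ ⋃ i, Metric.ball (x i) δ, 0 < f y) {φ : Space d → ℝ} {C : ℝ}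
    (hφ : Measurable φ) (hC : ∀ y, |φ y| ≤ C) {s I : Fin m → ℝ}
    (hloc : ∀ i, Tendsto (fun t : ℝ => t ^ (-s i) *
      ∫ y in Metric.ball (x i) δ, Real.exp (-f y / t) * φ y) (𝓝[>] 0) (𝓝 (I i)))
    {s₀ : ℝ} (hs₀ : ∀ i, s₀ ≤ s i) :
    Tendsto (fun t : ℝ => t ^ (-s₀) * ∫ y, Real.exp (-f y / t) * φ y) (𝓝[>] 0)
      (𝓝 (∑ i, if s i = s₀ then I i else 0)) := by
  have hU : IsOpen (⋃ i, Metric.ball (x i) δ) := isOpen_iUnion fun _ => Metric.isOpen_ball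
  -- The factor t^(s_i - s₀) kills the minima whose exponent exceeds s₀.
  have h1 : ∀ i, Tendsto (fun t : ℝ => t ^ (s i - s₀) * (t ^ (-s i) *
      ∫ y in Metric.ball (x i) δ, Real.exp (-f y / t) * φ y)) (𝓝[>] 0)
      (𝓝 (if s i = s₀ then I i else 0)) := by
    intro i
    split_ifs with h
    · simpa [h] using hloc i
    · have := (tendsto_rpow_zero_nhdsGT
        (sub_pos.2 (lt_of_le_of_ne (hs₀ i) (Ne.symm h)))).mul (hloc i)
      rwa [zero_mul] at this
  have h2 := (tendsto_finsetSum Finset.univ fun i _ => h1 i).add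
    (tendsto_laplace_off_open hf hco hint hU hpos hC s₀)
  rw [add_zero] at h2
  refine h2.congr' ?_
  filter_upwards [Ioo_mem_nhdsGT (zero_lt_one' ℝ)] with t ht
  have hI := integrable_exp_neg_div_mul hf hnonneg hint ht.1 ht.2.le hφ hC
  rw [← integral_add_compl hU.measurableSet hI,
    integral_iUnion_fintype (fun i => measurableSet_ball) hdisj (fun i => hI.integrableOn), mul_add,
    Finset.mul_sum]
  congr 1
  refine Finset.sum_congr rfl fun i _ => ?_
  rw [← mul_assoc, ← Real.rpow_add ht.1]
  congr 2
  ring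

theorem isProbabilityMeasure_gibbs (hf : Continuous f) (hnonneg : ∀ y, 0 ≤ f y)
    (hint : Integrable (fun y => Real.exp (-f y)) volume) {t : ℝ} (ht : 0 < t) (ht1 : t ≤ 1) :
    IsProbabilityMeasure (gibbs f t) :=
  isProbabilityMeasure_tilted (integrable_exp_neg_div hf hnonneg hint ht ht1)

theorem setIntegral_gibbs (t : ℝ) {A : Set (Space d)} (φ : Space d → ℝ) :
    ∫ y in A, φ y ∂(gibbs f t)
      = (∫ y, Real.exp (-f y / t))⁻¹ * ∫ y in A, Real.exp (-f y / t) * φ y := by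
  rw [gibbs, setIntegral_tilted, ← integral_const_mul]
  refine integral_congr_ae (Eventually.of_forall fun y => ?_)
  simp only [smul_eq_mul]
  ring

theorem exists_pairwise_disjoint_balls {x : Fin m → Space d} (hx : Function.Injective x) :
    ∃ δ > 0, Pairwise (fun i k => Disjoint (Metric.ball (x i) δ) (Metric.ball (x k) δ)) := by
  have h : ∀ᶠ δ : ℝ in 𝓝[>] 0, ∀ i k, i ≠ k → δ + δ ≤ dist (x i) (x k) := by
    refine eventually_all.2 fun i => eventually_all.2 fun k => ?_
    by_cases hik : i = k
    · exact Eventually.of_forall fun _ h => absurd hik h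
    · have hd : 0 < dist (x i) (x k) / 2 := half_pos (dist_pos.2 (hx.ne hik))
      filter_upwards [Ioo_mem_nhdsGT hd] with δ hδ _
      linarith [hδ.2]
  obtain ⟨δ, h1, h2⟩ := (h.and self_mem_nhdsWithin).exists
  exact ⟨δ, h2, fun i k hik => Metric.ball_disjoint_ball (h1 i k hik)⟩

/-- Quotient of the global asymptotics for φ and for 1, in which the common power of t cancels. -/
theorem weaklyConverges_diracMixture (hf : Continuous f) (hco : Coercive f)
    (hnonneg : ∀ y, 0 ≤ f y) (hint : Integrable (fun y => Real.exp (-f y)) volume)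
    {x : Fin m → Space d} {δ : ℝ}
    (hdisj : Pairwise (fun i k => Disjoint (Metric.ball (x i) δ) (Metric.ball (x k) δ)))
    (hpos : ∀ y ∉ ⋃ i, Metric.ball (x i) δ, 0 < f y) {a : Fin m → Fin d → ℝ} {w : Fin m → ℝ}
    (hw : ∀ i, 0 < w i) (hm : 0 < m)
    (hloc : ∀ i, ∀ φ : BoundedContinuousFunction (Space d) ℝ,
      Tendsto (fun t : ℝ => t ^ (-∑ j, a i j) *
        ∫ y in Metric.ball (x i) δ, Real.exp (-f y / t) * φ y) (𝓝[>] 0) (𝓝 (w i * φ (x i)))) :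
    WeaklyConverges (gibbs f) (diracMixture (minimalIndices a) w x) := by
  have : Nonempty (Fin m) := ⟨⟨0, hm⟩⟩
  obtain ⟨i₀, hi₀⟩ := exists_eq_ciInf_of_finite (f := fun i => ∑ j, a i j)
  set s₀ := ∑ j, a i₀ j with hs₀def
  have hs₀ : ∀ i, s₀ ≤ ∑ j, a i j := fun i => by
    rw [hi₀]; exact ciInf_le (Set.finite_range _).bddBelow i
  have hJ : ∀ i, i ∈ minimalIndices a ↔ ∑ j, a i j = s₀ := by
    intro i
    simp only [minimalIndices, Finset.mem_filter, Finset.mem_univ, true_and]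
    exact ⟨fun h => le_antisymm (h i₀) (hs₀ i), fun h k => h ▸ hs₀ k⟩
  have hsumJ : ∀ I : Fin m → ℝ, (∑ i, if ∑ j, a i j = s₀ then I i else 0)
      = ∑ i ∈ minimalIndices a, I i := by
    intro I
    simp only [← hJ]
    rw [← Finset.sum_filter]
    congr 1
    ext i
    simp
  have hWpos : 0 < ∑ k ∈ minimalIndices a, w k :=
    Finset.sum_pos (fun i _ => hw i) ⟨i₀, (hJ i₀).2 rfl⟩
  refine ⟨?_, ⟨?_⟩, fun φ => ?_⟩
  · filter_upwards [Ioo_mem_nhdsGT (zero_lt_one' ℝ)] with t ht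
    exact isProbabilityMeasure_gibbs hf hnonneg hint ht.1 ht.2.le
  · rw [diracMixture, Measure.coe_finsetSum, Finset.sum_apply]
    simp only [Measure.smul_apply, measure_univ, smul_eq_mul, mul_one]
    rw [← ENNReal.ofReal_sum_of_nonneg fun i _ => (div_pos (hw i) hWpos).le, ← Finset.sum_div,
      div_self hWpos.ne', ENNReal.ofReal_one]
  · have hν : ∫ y, φ y ∂(diracMixture (minimalIndices a) w x)
        = (∑ i ∈ minimalIndices a, w i * φ (x i)) / ∑ k ∈ minimalIndices a, w k := by
      rw [diracMixture, integral_finsetSum_measure, Finset.sum_div]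
      · refine Finset.sum_congr rfl fun i _ => ?_
        rw [integral_smul_measure, integral_dirac,
          ENNReal.toReal_ofReal (div_pos (hw i) hWpos).le, smul_eq_mul]
        ring
      · intro i _
        exact (integrable_dirac (by simp)).smul_measure ENNReal.ofReal_ne_top
    have h1 := tendsto_global_laplace hf hco hnonneg hint hdisj hpos (φ := φ)
      φ.continuous.measurable (fun y => φ.norm_coe_le_norm y) (fun i => hloc i φ) hs₀
    have h2 := tendsto_global_laplace hf hco hnonneg hint hdisj hpos (φ := fun _ => (1 : ℝ))
      measurable_const (C := 1) (fun y => by simp)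
      (fun i => by simpa using hloc i (BoundedContinuousFunction.const _ 1)) hs₀
    rw [hsumJ] at h1 h2
    rw [hν]
    refine (h1.div h2 hWpos.ne').congr' ?_
    filter_upwards [self_mem_nhdsWithin] with t ht
    have := setIntegral_gibbs (f := f) t (A := Set.univ) φ
    rw [Measure.restrict_univ, Measure.restrict_univ] at this
    simp only [mul_one]
    rw [this, Pi.div_apply, mul_div_mul_left _ _ (Real.rpow_pos_of_pos ht _).ne',
      div_eq_inv_mul]

/-- In the quotient of the local asymptotics for φ and for 1, both the Gibbs normalization and the
power of t cancel. -/
theorem weaklyConverges_conditional (hf : Continuous f)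
    (hnonneg : ∀ y, 0 ≤ f y) (hint : Integrable (fun y => Real.exp (-f y)) volume)
    {x : Space d} {δ : ℝ} (hδ : 0 < δ) {g : Space d → ℝ}
    (hg : Integrable (fun h => Real.exp (-g h)) volume) {s : ℝ} {T : ℝ → Space d → Space d}
    (hT : ∀ t, Measurable (T t))
    (hloc : ∀ φ : BoundedContinuousFunction (Space d) ℝ,
      Tendsto (fun t : ℝ => t ^ (-s) *
        ∫ y in Metric.ball x δ, Real.exp (-f y / t) * φ (T t y)) (𝓝[>] 0)
        (𝓝 (∫ h, Real.exp (-g h) * φ h))) :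
    WeaklyConverges (fun t => Measure.map (T t)
      (ProbabilityTheory.cond (gibbs f t) (Metric.ball x δ)))
      ((volume : Measure (Space d)).tilted (fun h => -g h)) := by
  have hgpos : 0 < ∫ h, Real.exp (-g h) := integral_exp_pos hg
  refine ⟨?_, isProbabilityMeasure_tilted hg, fun φ => ?_⟩
  · filter_upwards [Ioo_mem_nhdsGT (zero_lt_one' ℝ)] with t ht
    have := isProbabilityMeasure_gibbs hf hnonneg hint ht.1 ht.2.le
    have hne : gibbs f t (Metric.ball x δ) ≠ 0 := fun h0 =>
      (Metric.measure_ball_pos volume x hδ).ne' (absolutelyContinuous_tilted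
        (integrable_exp_neg_div hf hnonneg hint ht.1 ht.2.le) h0)
    have := ProbabilityTheory.cond_isProbabilityMeasure hne
    exact Measure.isProbabilityMeasure_map (hT t).aemeasurable
  · have h1 := hloc φ
    have h2 := hloc (BoundedContinuousFunction.const _ 1)
    simp only [BoundedContinuousFunction.const_apply, mul_one] at h2
    have hν : ∫ h, φ h ∂((volume : Measure (Space d)).tilted (fun h => -g h))
        = (∫ h, Real.exp (-g h) * φ h) / ∫ h, Real.exp (-g h) := by
      rw [integral_tilted, ← integral_div]
      refine integral_congr_ae (Eventually.of_forall fun y => ?_)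
      simp only [smul_eq_mul]
      ring
    rw [hν]
    refine (h1.div h2 hgpos.ne').congr' ?_
    filter_upwards [Ioo_mem_nhdsGT (zero_lt_one' ℝ)] with t ht
    have := isProbabilityMeasure_gibbs hf hnonneg hint ht.1 ht.2.le
    have hZ : 0 < ∫ y, Real.exp (-f y / t) :=
      integral_exp_pos (integrable_exp_neg_div hf hnonneg hint ht.1 ht.2.le)
    have hball : (gibbs f t (Metric.ball x δ)).toReal
        = (∫ y, Real.exp (-f y / t))⁻¹ * ∫ y in Metric.ball x δ, Real.exp (-f y / t) := by
      have h3 := setIntegral_gibbs (f := f) t (A := Metric.ball x δ) (fun _ => (1 : ℝ))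
      simpa [Measure.real] using h3
    rw [integral_map (hT t).aemeasurable φ.continuous.measurable.aestronglyMeasurable,
      ProbabilityTheory.cond, integral_smul_measure, setIntegral_gibbs, ENNReal.toReal_inv, hball,
      smul_eq_mul, Pi.div_apply, mul_div_mul_left _ _ (Real.rpow_pos_of_pos ht.1 _).ne',
      mul_inv, inv_inv, mul_mul_mul_comm, mul_inv_cancel₀ hZ.ne', one_mul, div_eq_inv_mul]

end Global

end GibbsWell

/-! ### The main theorem -/

theorem mainTheorem3 (d m p : ℕ) (f : GibbsWell.Space d → ℝ)
    (x : Fin m → GibbsWell.Space d) (q : Fin m → ℕ)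
    (hf : ContDiff ℝ ((2 * p : ℕ) : WithTop ℕ∞) f)
    (hcoercive : GibbsWell.Coercive f)
    (hx : Function.Injective x)
    (hargmin : GibbsWell.argmin f = Set.range x)
    (hzero : ∀ i, f (x i) = 0)
    (hq : ∀ i, q i ≤ p)
    (hmin : ∀ i, GibbsWell.IsStrictPolynomialMin f (x i) (q i))
    (hint : Integrable (fun y => Real.exp (-f y)) volume)
    (B : Fin m → (GibbsWell.Space d ≃ₗᵢ[ℝ] GibbsWell.Space d))
    (hB : ∀ i, GibbsWell.IsAdapted (B i) (GibbsWell.subE f (x i) (q i)))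
    (heven : ∀ i, 5 ≤ q i → GibbsWell.EvenTermsVanish f (x i) (q i)) :
    let α : Fin m → Fin d → ℝ := fun i => GibbsWell.exponent (GibbsWell.subE f (x i) (q i))
    let g : Fin m → GibbsWell.Space d → ℝ := fun i => GibbsWell.limitG f (x i) (q i) (B i)
    (∀ i,
      (∀ h, 0 ≤ g i h ∧
        Tendsto
          (fun t : ℝ => (1 / t) *
            f (x i + B i (GibbsWell.hadamard (GibbsWell.powVec t (α i)) h)))
          (𝓝[>] 0) (𝓝 (g i h))) ∧
      GibbsWell.NonconstantInEachVariable (g i)) ∧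
    ((∀ i, GibbsWell.Coercive (g i)) →
      (∀ i, Integrable (fun h => Real.exp (-g i h)) volume) ∧
      GibbsWell.WeaklyConverges (GibbsWell.gibbs f)
        (GibbsWell.diracMixture (GibbsWell.minimalIndices α)
          (fun i => ∫ h, Real.exp (-g i h)) x) ∧
      ∀ δ : ℝ, 0 < δ →
        Pairwise (fun i k => Disjoint (Metric.ball (x i) δ) (Metric.ball (x k) δ)) →
        ∀ i, GibbsWell.WeaklyConverges
          (fun t => Measure.map
            (fun y => GibbsWell.hadamard (GibbsWell.invPowVec t (α i)) ((B i).symm (y - x i)))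
            (ProbabilityTheory.cond (GibbsWell.gibbs f t) (Metric.ball (x i) δ)))
          ((volume : Measure (GibbsWell.Space d)).tilted (fun h => -g i h))) := by
  intro α g
  have hp1 : ∀ i, 1 ≤ q i := fun i => (hmin i).isLeast.1.1
  have hκ : ∀ i, ∃ κ : Fin d → Fin (q i), ∀ l j,
      l ∈ GibbsWell.block (GibbsWell.subE f (x i) (q i)) j ↔ κ l = j := fun i =>
    GibbsWell.exists_blockIndex (GibbsWell.sum_finrank_subE (hp1 i))
  choose κ hκ using hκ
  have hlim := fun i => GibbsWell.tendsto_rescaled (hmin i) (hzero i) (heven i) (hB i) (hκ i)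
  have hg0 := fun i => GibbsWell.limitG_nonneg (hmin i) (hzero i) (heven i) (hB i) (hκ i)
  refine ⟨fun i => ⟨fun h => ⟨hg0 i h, hlim i h⟩,
    GibbsWell.limitG_nonconstant (hmin i) (hzero i) (heven i) (hB i) (hκ i)⟩, fun hco => ?_⟩
  have hfc : Continuous f := hf.continuous
  -- A continuous coercive function attains its minimum, so there is at least one minimizer.
  have hm : 0 < m := by
    obtain ⟨y, hy⟩ := hfc.exists_forall_le
      (by rw [← Metric.cobounded_eq_cocompact]; exact hcoercive)
    have hy' : y ∈ GibbsWell.argmin f := hy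
    rw [hargmin] at hy'
    obtain ⟨i, -⟩ := hy'
    exact i.pos
  have hxmin : ∀ i y, f (x i) ≤ f y := fun i =>
    (hargmin ▸ Set.mem_range_self i : x i ∈ GibbsWell.argmin f)
  have hnonneg : ∀ y, 0 ≤ f y := fun y => hzero ⟨0, hm⟩ ▸ hxmin ⟨0, hm⟩ y
  have hfpos : ∀ y, y ∉ Set.range x → 0 < f y := by
    intro y hy
    refine (hnonneg y).lt_of_ne' fun h0 => hy ?_
    rw [← hargmin]
    exact fun z => h0 ▸ hnonneg z
  have hα := fun i => GibbsWell.exponent_eq (hκ i)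
  have hlow := fun i => GibbsWell.exists_mul_gauge_le (κ i) (hα i)
    (GibbsWell.continuous_limitG (B := B i)) (hg0 i)
    (fun t ht h => GibbsWell.limitG_scale (hB i) (hκ i) ht h) (hco i)
  have hgint : ∀ i, Integrable (fun h => Real.exp (-g i h)) volume := by
    intro i
    obtain ⟨c, hc, hcg⟩ := hlow i
    have hgc : Continuous (g i) := GibbsWell.continuous_limitG
    refine (GibbsWell.integrable_exp_neg_gauge (κ i) hc).mono' (by fun_prop)
      (Eventually.of_forall fun h => ?_)
    rw [Real.norm_of_nonneg (Real.exp_pos _).le]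
    exact Real.exp_le_exp.2 (neg_le_neg (hcg h))
  have hzero' := fun i => GibbsWell.tendsto_hadamard_powVec_zero (hκ i)
  have hball : ∀ δ : ℝ, 0 < δ →
      Pairwise (fun i k => Disjoint (Metric.ball (x i) δ) (Metric.ball (x k) δ)) →
      ∀ i, ∃ c > 0, ∀ h, ‖h‖ ≤ δ → c * GibbsWell.gauge (κ i) h ≤ f (x i + B i h) := by
    intro δ hδ hdisj i
    obtain ⟨c, hc, hcg⟩ := hlow i
    refine GibbsWell.exists_mul_gauge_le_on_closedBall (κ i)
      (hfc.comp (continuous_const.add (B i).continuous))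
      (GibbsWell.sub_limitG_isLittleO_gauge (hmin i) (hzero i) (heven i) (hB i) (hκ i)) hc hcg ?_
    rintro h hh hh0
    refine hfpos _ ?_
    rintro ⟨k, hk⟩
    have hk : x k = x i + B i h := hk
    have hki : k ≠ i := by
      rintro rfl
      exact hh0 ((B k).map_eq_zero_iff.1 (left_eq_add.1 hk))
    -- Only the open balls are disjoint, but another minimizer on the boundary sphere is excluded
    -- too: its own open ball would meet the one around `x i`.
    have h1 : x k ∈ closure (Metric.ball (x i) δ) := by
      rw [closure_ball _ hδ.ne', hk, Metric.mem_closedBall, dist_eq_norm, add_sub_cancel_left,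
        LinearIsometryEquiv.norm_map]
      exact hh
    exact (Set.disjoint_left.1 ((hdisj hki).closure_right Metric.isOpen_ball)
      (Metric.mem_ball_self hδ)) h1
  refine ⟨hgint, ?_, fun δ hδ hdisj i => ?_⟩
  · obtain ⟨δ, hδ, hdisj⟩ := GibbsWell.exists_pairwise_disjoint_balls hx
    refine GibbsWell.weaklyConverges_diracMixture hfc hcoercive hnonneg hint hdisj
      (fun y hy => hfpos y ?_) (fun i => integral_exp_pos (hgint i)) hm fun i φ => ?_
    · rintro ⟨k, rfl⟩
      exact hy (Set.mem_iUnion.2 ⟨k, Metric.mem_ball_self hδ⟩)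
    · obtain ⟨c, hc, hcf⟩ := hball δ hδ hdisj i
      -- The limit is the local Laplace integral with constant ψ = φ(x_i).
      rw [← integral_mul_const]
      refine GibbsWell.tendsto_local_laplace (κ i) (hα i) hfc (hlim i) (hzero' i) hδ hc hcf
        (Φ := fun _ => φ) (C := ‖φ‖) (fun _ => φ.continuous.measurable)
        (fun _ y => φ.norm_coe_le_norm y) fun h => ?_
      have h1 := (((B i).continuous.tendsto 0).comp (hzero' i h)).const_add (x i)
      rw [map_zero, add_zero] at h1
      exact (φ.continuous.tendsto _).comp h1
  · have hT : ∀ t, Measurable (fun y => GibbsWell.hadamard (GibbsWell.invPowVec t (α i))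
        ((B i).symm (y - x i))) := fun t =>
      (GibbsWell.measurable_hadamard _).comp
        ((B i).symm.continuous.measurable.comp (measurable_id.sub_const _))
    refine GibbsWell.weaklyConverges_conditional hfc hnonneg hint hδ (hgint i) hT
      (s := ∑ j, α i j) fun φ => ?_
    obtain ⟨c, hc, hcf⟩ := hball δ hδ hdisj i
    refine GibbsWell.tendsto_local_laplace (κ i) (hα i) hfc (hlim i) (hzero' i) hδ hc hcf
      (Φ := fun t y => φ (GibbsWell.hadamard (GibbsWell.invPowVec t (α i))
        ((B i).symm (y - x i)))) (C := ‖φ‖) (fun t => φ.continuous.measurable.comp (hT t))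
      (fun _ y => φ.norm_coe_le_norm _) fun h => ?_
    -- At the scaled point `Φ` equals φ(h) exactly, for every t > 0.
    refine tendsto_const_nhds.congr' ?_
    filter_upwards [self_mem_nhdsWithin] with t ht
    rw [add_sub_cancel_left, LinearIsometryEquiv.symm_apply_apply]
    congr 1
    ext l
    have := (Real.rpow_pos_of_pos (show (0 : ℝ) < t from ht) (α i l)).ne'
    change h l = 1 / t ^ α i l * (t ^ α i l * h l)
    field_simp
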